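/- **Setting.** Let $1\le L\le L_{\max}$ and $i_{\max}\ge 1$ be integers, $\epsilon = 200^{-(L_{\max}+i_{\max}+1)}$, $\epsilon_i = 100^{i+1}\epsilon$, $\tau_{\max}=1000/\epsilon^3$, $T=\{1,\dots,\tau_{\max}\}$, $\alpha_l = 2^{(20000/\epsilon^2)^l}$, $c_L = 100\,\alpha_{L-1}$. Let $A,B$ be strings of length $n=d^2$, and let $\gamma\ge 1$ be an integer dividing $n-d$. Let $\mathcal A$ be the set of the $d$ consecutive windows of width $d$ of $A$, and $\mathcal B$ the set of the windows of width $d$ of $B$ that start at the (0-based) positions $0,\gamma,2\gamma,\dots,n-d$. Windows are identified by their positions; $s(x)$ is the starting position of $x$. Let $t=|\mathcal A|+|\mathcal B|$ and assume $t\ge (1000/\epsilon^{10})^{4^{L+1}/\epsilon}$. Put $\rho=t^{1/i_{\max}}$, and let $b=\lceil t^{\epsilon}\rceil$ (so $b = t^{\epsilon}$ if this is an integer). For $\ell\ge 1$ let $\operatorname{snap}(\ell)$ be the largest power of $b$ that is at most $\ell$, and $\operatorname{snap}(0)=0$. Let $\mathcal I$ be the set of intervals obtained by cutting each of $\mathcal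 A$ and $\mathcal B$ into consecutive blocks of length $b^k$, for each $k\in\{0,\dots,1/\epsilon\}$ (the last block may be truncated). For $\lambda\in\{1,7\}$ and $I\in\mathcal I$, let $\lambda I$ be $I$ together with the $(\lambda-1)/2$ blocks of the same length on either side of it, truncated at the ends of $\mathcal A$ or $\mathcal B$. Let $\Delta>0$, let $\operatorname{ED}$ be the edit distance, and let $\widehat{\operatorname{ED}}$ be any symmetric function on pairs of windows (the accurate answers of $\textsc{Main}(\cdot,\cdot,\Delta,L-1)$) with $\operatorname{ED}(x,y)\le\widehat{\operatorname{ED}}(x,y)\le\alpha_{L-1}(\operatorname{ED}(x,y)+\Delta)$ for all $x,y\in\mathcal A\cup\mathcal B$. For a set $\mathcal L\subseteq\mathcal A\cup\mathcal B$ of live windows, $x\in\mathcal L$ and $\tau\in T$, let $C(x,\tau)=\{y\in\mathcal L:\widehat{\operatorname{ED}}(x,y)\le\Delta c_L^{\tau}\}$. This clique is *big* if $\operatorname{snap}|C(x,\tau)|/\operatorname{snap}|\mathcal L|>\rho^{-1}$. Let $\mathcal L(x,\tau)$ be the union of the sets $\mathcal L\cap 7I$ over all $I\in\mathcal I$ with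 $$\frac{\operatorname{snap}|C(x,\tau)\cap 7I|}{\operatorname{snap}|\mathcal L\cap 7I|}\cdot\frac{\operatorname{snap}|\mathcal L|}{\operatorname{snap}|C(x,\tau)|}\ge\rho .$$ **Algorithm.** $\textsc{Query}$, called at level $i$ on $\mathcal L$, outputs a set of pairs of windows. If $i=i_{\max}$, it outputs all $(x,y)\in\mathcal L^2$ with $\widehat{\operatorname{ED}}(x,y)\le\Delta c_L$. If $i<i_{\max}$, it repeats the following $\lceil t^{\epsilon_{i+1}}\rho\rceil$ times, independently, and outputs the union of the results: draw $x\in\mathcal L$ and $\tau\in T$ uniformly at random; if $C(x,\tau)$ is big, output $C(x,\tau)\times C(x,\tau)$; otherwise output the result of $\textsc{Query}$ at level $i+1$ on $\mathcal L(x,\tau)$. The root of the *algorithm tree* is $\mathcal L^0=\mathcal A\cup\mathcal B$ at level $0$; the children of a node $\mathcal L^i$ at level $i<i_{\max}$ are the sets $\mathcal L^i(x,\tau)$, at level $i+1$, for which $C(x,\tau)$ is not big. **Matching.** Let $\mu:\mathcal A\to\mathcal B\cup\{\bot\}$ be monotone, with $\operatorname{ED}(a,\mu(a))\le\Delta$ whenever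 $\mu(a)\ne\bot$, and with skew at most $2$, that is, $\tfrac12|s(a)-s(a')|\le|s(\mu(a))-s(\mu(a'))|\le 2|s(a)-s(a')|$ whenever $\mu(a),\mu(a')\neq\bot$. Extend $\mu$ to a partial involution of $\mathcal A\cup\mathcal B$, and write $\mu(K)=\{\mu(y):y\in K,\ \mu(y)\ne\bot\}$. For a node $\mathcal L^i$ at level $i$, let $\mathcal L^i_{dd}$ be the set of $y\in\mathcal L^i$ such that $$\frac{|\mathcal L^i\cap\lambda J|/|\lambda J|}{|\mathcal L^i\cap\lambda I|/|\lambda I|}\le t^{3\epsilon_i}$$ for all $\lambda\in\{1,7\}$ and all $I,J\in\mathcal I$ with $y\in\lambda I$ such that $J$ contains $I$ and is a block of a longer block length, and let $\mathcal L^i_{good}=\mathcal L^i_{dd}\cap\mu(\mathcal L^i_{dd})$. The node is *active* if $|\mathcal L^i_{good}|/|\mathcal L^i|\ge t^{-\epsilon_i}$. A window $y$ *survives* if $y\in\mathcal L^i_{good}$ and $\textsc{Query}$, called at level $i$ on $\mathcal L^i$, outputs the edge $(y,\mu(y))$ with probability at least $1-e^{-t^{\epsilon_i}}$. **Lemma 26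 (main inductive step).** Let $\mathcal L^i$ be an active node at level $i\in\{0,\dots,i_{\max}\}$ of the algorithm tree. Then all but at most a $2t^{-\epsilon_i}$ fraction of the windows $y\in\mathcal L^i\cap\mu(\mathcal L^i)$ survive. -/

import Mathlib

namespace EDQuery

/-- A single edit operation: the insertion, deletion or substitution of one character. -/
inductive EditStep {S : Type*} : List S → List S → Prop
  | insertion (u v : List S) (c : S) : EditStep (u ++ v) (u ++ c :: v)
  | deletion (u v : List S) (c : S) : EditStep (u ++ c :: v) (u ++ v)
  | substitution (u v : List S) (c c' : S) : EditStep (u ++ c :: v) (u ++ c' :: v)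

/-- `EditChain k x y`: the string `x` can be transformed into `y` by `k` edit operations. -/
inductive EditChain {S : Type*} : ℕ → List S → List S → Prop
  | refl (x : List S) : EditChain 0 x x
  | step {k : ℕ} {x y z : List S} (h : EditChain k x y) (h1 : EditStep y z) : EditChain (k + 1) x z

/-- The edit distance: the minimum number of edit operations that transform `x` into `y`. -/
noncomputable def editDist {S : Type*} (x y : List S) : ℕ := sInf {k | EditChain k x y}

/-- The windows of the two strings: the left summand is the family `𝒜` of the `n / d = d` consecutive
windows of `A`, the right summand the family `ℬ` of the `(n - d) / γ + 1` windows of `B` with spacing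
`γ` (where `n = d ^ 2`). Windows are identified by their position, not by their text. -/
abbrev Window (d γ : ℕ) : Type := Fin d ⊕ Fin ((d ^ 2 - d) / γ + 1)

/-- The input data of the query algorithm. `Lmax` is the top level of the outer recursion `MAIN` and
`L` the current one, `imax` is the depth of the tree of the query algorithm, `A` and `B` are the
strings (of length `n = d ^ 2`), `d` is the window width, `γ` the spacing of the windows of `B`,
`Δ` the distance threshold, and `est x y` is the value `MAIN(x, y, Δ, L - 1)`. -/
structure QueryInput (S : Type*) where
  Lmax : ℕ
  L : ℕ
  imax : ℕ
  d : ℕ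
  γ : ℕ
  A : List S
  B : List S
  Δ : ℝ
  est : Window d γ → Window d γ → ℝ

namespace QueryInput

variable {S : Type*} (P : QueryInput S)

/-- The windows of the instance. -/
abbrev Win : Type := Window P.d P.γ

/-! ### Windows and their edit distance -/

/-- The (0-based) starting position of a window in its string. -/
def start : P.Win → ℕ
  | Sum.inl a => a * P.d
  | Sum.inr b => b * P.γ

/-- The text of a window, a substring of length `d`. -/
def text : P.Win → List S
  | Sum.inl a => (P.A.drop (a * P.d)).take P.d
  | Sum.inr b => (P.B.drop (b * P.γ)).take P.d

/-- The edit distance of two windows. -/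
noncomputable def ED (x y : P.Win) : ℕ := editDist (P.text x) (P.text y)

/-! ### Parameters -/

/-- The number `1 / ε = 200 ^ (Lmax + imax + 1)`, an integer. -/
def invEps : ℕ := 200 ^ (P.Lmax + P.imax + 1)

/-- `ε = 1 / 200 ^ (Lmax + imax + 1)`. -/
noncomputable def eps : ℝ := 1 / (P.invEps : ℝ)

/-- `ε_i = 100 ^ (i + 1) * ε`. -/
noncomputable def epsLevel (i : ℕ) : ℝ := (100 : ℝ) ^ (i + 1) * P.eps

/-- The number of windows `t = |𝒜| + |ℬ|`. -/
def t : ℕ := Fintype.card P.Win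

/-- `t_min = (1000 / ε ^ 10) ^ (4 ^ (L + 1) / ε)`. -/
def tMin : ℕ := (1000 * P.invEps ^ 10) ^ (4 ^ (P.L + 1) * P.invEps)

/-- `α_l = 2 ^ ((20000 / ε ^ 2) ^ l)`, the approximation factor of `MAIN` at level `l`. -/
noncomputable def alpha (l : ℕ) : ℝ := (2 : ℝ) ^ ((20000 * P.invEps ^ 2) ^ l)

/-- `c_L = 100 * α_{L - 1}`. -/
noncomputable def cL : ℝ := 100 * P.alpha (P.L - 1)

/-- `τ_max = 1000 / ε ^ 3`. -/
def tauMax : ℕ := 1000 * P.invEps ^ 3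

/-- The set `T = {1, …, τ_max}` of distance thresholds. -/
def thresholds : Finset ℕ := Finset.Icc 1 P.tauMax

theorem thresholds_nonempty : P.thresholds.Nonempty :=
  ⟨1, Finset.mem_Icc.2 ⟨le_rfl, Nat.succ_le_of_lt
    (Nat.mul_pos (by norm_num) (pow_pos (pow_pos (by norm_num) _) _))⟩⟩

/-- The density threshold `ρ = t ^ (1 / imax)`. -/
noncomputable def rho : ℝ := (P.t : ℝ) ^ (1 / (P.imax : ℝ))

/-- The integer `t ^ ε` (rounded up if it is not an integer). -/
noncomputable def base : ℕ := ⌈(P.t : ℝ) ^ P.eps⌉₊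

/-- `snap ℓ` is the largest power of `t ^ ε` which is at most `ℓ`, and `snap 0 = 0`. -/
noncomputable def snap (l : ℕ) : ℕ := if l = 0 then 0 else P.base ^ Nat.log P.base l

/-! ### Intervals -/

/-- Whether a window belongs to `𝒜` (`true`) or to `ℬ` (`false`). -/
def onA : P.Win → Bool
  | Sum.inl _ => true
  | Sum.inr _ => false

/-- The index of a window in its family. -/
def idx : P.Win → ℕ
  | Sum.inl a => a
  | Sum.inr b => b

end QueryInput

/-- A code for a block of consecutive windows: the block number `block` (starting at 0) among the
consecutive blocks of `(t ^ ε) ^ level` windows of `𝒜` (if `side = true`) or of `ℬ`. -/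
structure Interval where
  side : Bool
  level : ℕ
  block : ℕ

namespace QueryInput

variable {S : Type*} (P : QueryInput S)

/-- For odd `m`, the interval `m I`: the block `I` together with the `(m - 1) / 2` blocks of the same
length on either side of it, truncated at the ends of `𝒜` or `ℬ`. -/
noncomputable def scaled (m : ℕ) (I : Interval) : Finset P.Win :=
  Finset.univ.filter fun w => P.onA w = I.side ∧
    I.block * P.base ^ I.level ≤ P.idx w + (m - 1) / 2 * P.base ^ I.level ∧
    P.idx w < (I.block + 1 + (m - 1) / 2) * P.base ^ I.level

/-- The set `𝓘` of intervals: for each length `(t ^ ε) ^ k`, `0 ≤ k ≤ 1 / ε`, the consecutive blocks of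
this length, which cover `𝒜` and `ℬ`; the last block is truncated at the end of the string. -/
def intervals : Set Interval := {I | I.level ≤ P.invEps ∧ (P.scaled 1 I).Nonempty}

/-! ### Cliques, densities and the live windows of the next level -/

open Classical in
/-- The clique `C(x, τ)` of a live window `x` within the set `live` of live windows. -/
noncomputable def clique (live : Finset P.Win) (x : P.Win) (τ : ℕ) : Finset P.Win :=
  live.filter fun y => P.est x y ≤ P.Δ * P.cL ^ τ

/-- The global density of a clique `C` in the set of live windows. -/
noncomputable def globalDensity (live C : Finset P.Win) : ℝ :=
  (P.snap C.card : ℝ) / (P.snap live.card : ℝ)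

/-- The local density of a clique `C` on the set of windows `K`. -/
noncomputable def localDensity (live C K : Finset P.Win) : ℝ :=
  (P.snap (C ∩ K).card : ℝ) / (P.snap (live ∩ K).card : ℝ)

/-- The relative density of a clique `C` on the set of windows `K`. -/
noncomputable def relDensity (live C K : Finset P.Win) : ℝ :=
  P.localDensity live C K / P.globalDensity live C

/-- Big cliques: those of global density greater than `1 / ρ`. -/
def IsBig (live C : Finset P.Win) : Prop := P.rho⁻¹ < P.globalDensity live C

open Classical in
/-- The live windows of the next level for the clique `C`: the live windows in the intervals `7 I`,
`I ∈ 𝓘`, on which `C` has relative density at least `ρ`. -/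
noncomputable def nextLive (live C : Finset P.Win) : Finset P.Win :=
  live.filter fun w =>
    ∃ I ∈ P.intervals, P.rho ≤ P.relDensity live C (P.scaled 7 I) ∧ w ∈ P.scaled 7 I

/-! ### The randomized query algorithm and its tree -/

end QueryInput

/-- The union of the outputs of `m` independent runs of a procedure with output law `p`. -/
noncomputable def repeatUnion {α : Type*} [DecidableEq α] (p : PMF (Finset α)) :
    ℕ → PMF (Finset α)
  | 0 => PMF.pure ∅
  | m + 1 => p.bind fun X => (repeatUnion p m).map fun Y => X ∪ Y

namespace QueryInput

variable {S : Type*} (P : QueryInput S)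

open Classical in
/-- The law of the edge set that the query algorithm returns when it is called at level `i`, with `r`
levels remaining below it (`r + i = imax` in every call), on the set `live` of live windows.
* With no level remaining, all pairs of live windows are queried.
* Otherwise `t ^ ε_{i + 1} * ρ` times (rounded up), independently: a live window `x` and a threshold
  `τ` are drawn uniformly at random; if the clique `C` of `x` and `τ` is big, all pairs in `C × C` are
  output, and otherwise the algorithm is called at level `i + 1` on the new set of live windows. -/
noncomputable def query : ℕ → ℕ → Finset P.Win → PMF (Finset (P.Win × P.Win))
  | 0, _, live => PMF.pure ((live ×ˢ live).filter fun e => P.est e.1 e.2 ≤ P.Δ * P.cL)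
  | r + 1, i, live =>
    repeatUnion
      (if h : live.Nonempty then
        (PMF.uniformOfFinset live h).bind fun x =>
          (PMF.uniformOfFinset P.thresholds P.thresholds_nonempty).bind fun τ =>
            if P.IsBig live (P.clique live x τ) then
              PMF.pure (P.clique live x τ ×ˢ P.clique live x τ)
            else query r (i + 1) (P.nextLive live (P.clique live x τ))
      else PMF.pure ∅)
      ⌈(P.t : ℝ) ^ P.epsLevel (i + 1) * P.rho⌉₊

/-- `P.IsNode i live`: the algorithm tree has a node at level `i` with set of live windows `live`.
At the root all windows are live; the children of a node at a level below `imax` come from the choices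
of a live window `x` and a threshold `τ` for which the clique is not big. -/
inductive IsNode : ℕ → Finset P.Win → Prop
  | root : IsNode 0 Finset.univ
  | child {i : ℕ} {live : Finset P.Win} {x : P.Win} {τ : ℕ} (hnode : IsNode i live)
      (hi : i < P.imax) (hx : x ∈ live) (hτ : τ ∈ P.thresholds)
      (hsmall : ¬ P.IsBig live (P.clique live x τ)) :
      IsNode (i + 1) (P.nextLive live (P.clique live x τ))

/-- The probability that the edge `(y, z)` is discovered (output) by the call of the query algorithm
at level `i` on the set `live` of live windows. -/
noncomputable def discoveryProb (i : ℕ) (live : Finset P.Win) (y z : P.Win) : ℝ :=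
  ((P.query (P.imax - i) i live).toOuterMeasure {E | (y, z) ∈ E}).toReal

/-! ### The matching, good windows, active nodes, surviving windows -/

/-- A mapping `μ : 𝒜 → ℬ ∪ {⊥}` between the windows. -/
abbrev Mapping : Type := Fin P.d → Option (Fin ((P.d ^ 2 - P.d) / P.γ + 1))

variable {P}

/-- Monotone mappings. -/
def Mapping.IsMonotone (μ : P.Mapping) : Prop :=
  ∀ a a' b b', μ a = some b → μ a' = some b' → a ≤ a' → b ≤ b'

/-- The mapping has skew at most `D`. -/
def Mapping.SkewAtMost (μ : P.Mapping) (D : ℝ) : Prop :=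
  ∀ a a' b b', μ a = some b → μ a' = some b' →
    1 / D * |(P.start (Sum.inl a) : ℝ) - P.start (Sum.inl a')| ≤
        |(P.start (Sum.inr b) : ℝ) - P.start (Sum.inr b')| ∧
      |(P.start (Sum.inr b) : ℝ) - P.start (Sum.inr b')| ≤
        D * |(P.start (Sum.inl a) : ℝ) - P.start (Sum.inl a')|

/-- `z = μ(y)`, where `μ` is extended to a partial involution of `𝒜 ∪ ℬ`. -/
def Mapping.Matched (μ : P.Mapping) : P.Win → P.Win → Prop
  | Sum.inl a, Sum.inr b => μ a = some b
  | Sum.inr b, Sum.inl a => μ a = some b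
  | _, _ => False

open Classical in
/-- The image `μ(K) = {μ(y) : y ∈ K, μ(y) ≠ ⊥}` under the partial involution. -/
noncomputable def Mapping.image (μ : P.Mapping) (K : Finset P.Win) : Finset P.Win :=
  Finset.univ.filter fun z => ∃ y ∈ K, μ.Matched y z

variable (P)

/-- The live-density `|live ∩ K| / |K|`. -/
noncomputable def liveDensity (live K : Finset P.Win) : ℝ :=
  ((live ∩ K).card : ℝ) / (K.card : ℝ)

open Classical in
/-- The live windows with decreasing densities at level `i`: passing from an interval `m I` around the
window to `m J`, where `J` is a longer interval of `𝓘` that contains `I` and `m ∈ {1, 7}`, increases the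
live-density by a factor of at most `t ^ (3 ε_i)`. -/
noncomputable def decreasing (i : ℕ) (live : Finset P.Win) : Finset P.Win :=
  live.filter fun y => ∀ m ∈ ({1, 7} : Finset ℕ), ∀ I ∈ P.intervals, ∀ J ∈ P.intervals,
    y ∈ P.scaled m I → I.level < J.level → P.scaled 1 I ⊆ P.scaled 1 J →
      P.liveDensity live (P.scaled m J) / P.liveDensity live (P.scaled m I) ≤
        (P.t : ℝ) ^ (3 * P.epsLevel i)

/-- The good windows of a node at level `i`. -/
noncomputable def good (μ : P.Mapping) (i : ℕ) (live : Finset P.Win) : Finset P.Win :=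
  P.decreasing i live ∩ μ.image (P.decreasing i live)

/-- A node at level `i` is active if a fraction of at least `t ^ (-ε_i)` of its live windows is good. -/
def IsActive (μ : P.Mapping) (i : ℕ) (live : Finset P.Win) : Prop :=
  (P.t : ℝ) ^ (-P.epsLevel i) ≤ ((P.good μ i live).card : ℝ) / (live.card : ℝ)

/-- The window `y` survives the node with live windows `live` at level `i`: it is good, and the edge
`(y, μ(y))` is discovered below this node with probability at least `1 - exp (-t ^ ε_i)`. -/
def Survives (μ : P.Mapping) (i : ℕ) (live : Finset P.Win) (y : P.Win) : Prop :=
  y ∈ P.good μ i live ∧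
    ∃ z, μ.Matched y z ∧
      1 - Real.exp (-(P.t : ℝ) ^ P.epsLevel i) ≤ P.discoveryProb i live y z

end QueryInput

end EDQuery

/-!
For a clique `C`, the intervals on which `C` has relative density at least `ρ` contain about
`|live| / ρ` live windows in total, as at most `7 (1 / ε + 1)` scaled intervals contain any given window
(`Large.card_nextLive_le`). Hence a loss of a `t ^ (-ε_{i+1})` fraction at each child costs a
typical window only a `t ^ (-ε_{i+1})` part, up to lower order factors, of a probability of `1 / ρ`
(`Large.card_many_failures_le`). It remains to see that a typical good edge `{y, z}` is passed on to
a child with probability about `1 / ρ`; then about `t ^ ε_{i+1} ρ` repetitions suffice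
(`Large.hitProb_query_succ_ge`).

Snapping leaves few possible values for the sizes of the traces of the cliques `C(y, τ)` on the
intervals around `y` and `z`, so that for some threshold these do not change between `τ - 1` and
`τ + 1` (`Large.exists_stable`). By the triangle inequality all cliques `C(x, τ)` with `x` in
`C(y, τ - 1)` then look like `C(y, τ)`. If they are big, then they discover the edge, and `C(y, τ - 1)` has
density about `1 / ρ`. Otherwise consider the longest intervals around `y` and around `z` with
relative density at least `ρ`, and let `I` be the physically shorter one. The densities being
decreasing, the relative density on `I` is about `ρ` (`Large.card_mul_card_le_of_longest`). As the
skew is at most two, every choice of an `x` in `C(y, τ - 1)` is good for all edges that start in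
`I`, since their other ends lie in the scaled interval on the other side
(`Large.clique_subset_edgeHits`). If the edges of this kind are not a negligible part of `I`, then
their cliques cover a good part of `I`, each with relative density about `ρ`, so that together they
have global density about `1 / ρ`: with this probability the random window leads to a child which
contains all these edges (`Large.card_spread_block_le`).

Two facts make the induction go through. Few windows of any set violate the decreasing densities
(`Large.card_sdiff_decreasing_le`), and therefore the bound on the lost windows at active nodes
extends, relative to all live windows, to inactive nodes (`Large.card_lost_le`). This takes care of
children that are not active. All error terms are powers of `t ^ ε_i`, which dominates the fiftieth
power of the base of the snapping (`Large.base_pow_le`), while `ε_{i+1} = 100 ε_i`.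
-/

namespace EDQuery

/-! ### The edit distance -/

theorem EditChain.trans {S : Type*} {k l : ℕ} {x y z : List S} (h : EditChain k x y)
    (h' : EditChain l y z) : EditChain (k + l) x z := by
  induction h' with
  | refl => exact h
  | step _ h1 ih => exact (ih h).step h1

theorem EditChain.delete_all {S : Type*} (x : List S) : EditChain x.length x [] := by
  induction x with
  | nil => exact .refl _
  | cons c x ih =>
    have h : EditChain 1 (c :: x) x := (EditChain.refl _).step (EditStep.deletion [] x c)
    simpa [add_comm] using h.trans ih

theorem EditChain.insert_all {S : Type*} (x : List S) : EditChain x.length [] x := by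
  induction x with
  | nil => exact .refl _
  | cons c x ih => exact ih.step (EditStep.insertion [] x c)

theorem editChain_editDist {S : Type*} (x y : List S) : EditChain (editDist x y) x y :=
  Nat.sInf_mem (s := {k | EditChain k x y})
    ⟨_, (EditChain.delete_all x).trans (EditChain.insert_all y)⟩

theorem editDist_triangle {S : Type*} (x y z : List S) :
    editDist x z ≤ editDist x y + editDist y z :=
  Nat.sInf_le ((editChain_editDist x y).trans (editChain_editDist y z))

/-! ### Probabilities of random finite sets -/

/-- The probability that a random finite set with law `p` contains `e`. -/
noncomputable def hitProb {α : Type*} (p : PMF (Finset α)) (e : α) : ℝ :=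
  (p.toOuterMeasure {E | e ∈ E}).toReal

section hitProb

variable {α : Type*}

theorem toOuterMeasure_le_one {β : Type*} (p : PMF β) (s : Set β) : p.toOuterMeasure s ≤ 1 := by
  rw [PMF.toOuterMeasure_apply]
  exact (ENNReal.tsum_le_tsum fun x => Set.indicator_le_self _ _ _).trans p.tsum_coe.le

theorem hitProb_nonneg (p : PMF (Finset α)) (e : α) : 0 ≤ hitProb p e := ENNReal.toReal_nonneg

theorem hitProb_le_one (p : PMF (Finset α)) (e : α) : hitProb p e ≤ 1 :=
  ENNReal.toReal_mono ENNReal.one_ne_top (toOuterMeasure_le_one _ _)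

theorem hitProb_pure_of_mem {E : Finset α} {e : α} (h : e ∈ E) : hitProb (PMF.pure E) e = 1 := by
  simp [hitProb, h]

theorem hitProb_uniform_bind {β : Type*} (s : Finset β) (hs : s.Nonempty)
    (f : β → PMF (Finset α)) (e : α) :
    hitProb ((PMF.uniformOfFinset s hs).bind f) e = (∑ a ∈ s, hitProb (f a) e) / s.card := by
  classical
  unfold hitProb
  rw [PMF.toOuterMeasure_bind_apply, tsum_eq_sum (s := s)]
  · rw [ENNReal.toReal_sum, Finset.sum_div]
    · refine Finset.sum_congr rfl fun a ha => ?_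
      rw [PMF.uniformOfFinset_apply_of_mem hs ha, ENNReal.toReal_mul, ENNReal.toReal_inv]
      simp [div_eq_inv_mul]
    · intro a _
      exact ENNReal.mul_ne_top (PMF.apply_ne_top _ _)
        (ne_top_of_le_ne_top ENNReal.one_ne_top (toOuterMeasure_le_one _ _))
  · intro a ha
    rw [PMF.uniformOfFinset_apply_of_notMem hs ha, zero_mul]

theorem toOuterMeasure_notMem_repeatUnion [DecidableEq α] (p : PMF (Finset α)) (e : α) (m : ℕ) :
    (repeatUnion p m).toOuterMeasure {E | e ∉ E} = (p.toOuterMeasure {E | e ∉ E}) ^ m := by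
  induction m with
  | zero => simp [repeatUnion]
  | succ m ih =>
    rw [repeatUnion, PMF.toOuterMeasure_bind_apply, pow_succ', PMF.toOuterMeasure_apply,
      ← ENNReal.tsum_mul_right]
    refine tsum_congr fun X => ?_
    rw [PMF.toOuterMeasure_map_apply]
    by_cases h : e ∈ X
    · have : (fun Y => X ∪ Y) ⁻¹' {E | e ∉ E} = ∅ := by ext Y; simp [h]
      rw [this]; simp [h]
    · have : (fun Y => X ∪ Y) ⁻¹' {E | e ∉ E} = {E | e ∉ E} := by ext Y; simp [h]
      rw [this, ih]; simp [h, PMF.toOuterMeasure_apply]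

theorem toOuterMeasure_notMem (p : PMF (Finset α)) (e : α) :
    (p.toOuterMeasure {E | e ∉ E}).toReal = 1 - hitProb p e := by
  have h : p.toOuterMeasure {E | e ∈ E} + p.toOuterMeasure {E | e ∉ E} = 1 := by
    rw [PMF.toOuterMeasure_apply, PMF.toOuterMeasure_apply, ← ENNReal.tsum_add, ← p.tsum_coe]
    refine tsum_congr fun X => ?_
    by_cases h : e ∈ X <;> simp [h]
  have h2 := congrArg ENNReal.toReal h
  rw [ENNReal.toReal_add (ne_top_of_le_ne_top ENNReal.one_ne_top (toOuterMeasure_le_one _ _))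
    (ne_top_of_le_ne_top ENNReal.one_ne_top (toOuterMeasure_le_one _ _))] at h2
  simp only [ENNReal.toReal_one] at h2
  unfold hitProb
  linarith

/-- Amplification by independent repetition: `m` runs of a procedure with success probability at
least `q` fail with probability at most `(1 - q) ^ m ≤ exp (-q * m)`. -/
theorem hitProb_repeatUnion_ge [DecidableEq α] (p : PMF (Finset α)) (e : α) (m : ℕ) {q c : ℝ}
    (hq : q ≤ hitProb p e) (hc : c ≤ q * m) :
    1 - Real.exp (-c) ≤ hitProb (repeatUnion p m) e := by
  have h := congrArg ENNReal.toReal (toOuterMeasure_notMem_repeatUnion p e m)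
  rw [ENNReal.toReal_pow, toOuterMeasure_notMem, toOuterMeasure_notMem] at h
  have h1 : 1 - hitProb p e ≤ Real.exp (-q) := by
    have := Real.add_one_le_exp (-q); linarith
  have h2 : (1 - hitProb p e) ^ m ≤ Real.exp (-q) ^ m :=
    pow_le_pow_left₀ (by linarith [hitProb_le_one p e]) h1 m
  rw [← Real.exp_nat_mul] at h2
  have h3 : Real.exp (m * -q) ≤ Real.exp (-c) := Real.exp_le_exp.2 (by linarith)
  linarith

end hitProb

namespace QueryInput

variable {S : Type*} (P : QueryInput S)

/-! ### Size of the parameters -/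

theorem one_le_alpha (l : ℕ) : 1 ≤ P.alpha l := one_le_pow₀ (by norm_num)

theorem hundred_le_cL : 100 ≤ P.cL := by
  have := P.one_le_alpha (P.L - 1)
  unfold cL; linarith

theorem invEps_pos : 0 < P.invEps := pow_pos (by norm_num) _

theorem invEps_ge : 200 ≤ P.invEps := by
  unfold invEps
  calc 200 = 200 ^ 1 := by norm_num
    _ ≤ _ := Nat.pow_le_pow_right (by norm_num) (by omega)

theorem t_le_base_pow : P.t ≤ P.base ^ P.invEps := by
  have h : (P.t : ℝ) ^ P.eps ≤ P.base := Nat.le_ceil _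
  have h1 : ((P.t : ℝ) ^ P.eps) ^ P.invEps ≤ (P.base : ℝ) ^ P.invEps :=
    pow_le_pow_left₀ (by positivity) h _
  rw [eps, one_div, Real.rpow_inv_natCast_pow (by positivity) P.invEps_pos.ne'] at h1
  exact_mod_cast h1

theorem snap_le (l : ℕ) : P.snap l ≤ l := by
  unfold snap
  split_ifs with h
  · exact Nat.zero_le _
  · exact Nat.pow_log_le_self _ h

variable {P}

/-- The largeness hypotheses of the analysis: `t` exceeds a high power of `1 / ε`, so that even `t ^ ε`
dominates the polynomials in `1 / ε` that occur as numbers of lengths and of thresholds. -/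
structure Large (P : QueryInput S) : Prop where
  one_le_L : 1 ≤ P.L
  tMin_le : P.tMin ≤ P.t

namespace Large

variable (hP : P.Large)
include hP

theorem one_le_t : 1 ≤ P.t := by
  have h := P.invEps_ge
  refine le_trans ?_ hP.tMin_le
  exact Nat.one_le_pow _ _ (by positivity)

theorem one_le_t' : (1 : ℝ) ≤ P.t := by exact_mod_cast hP.one_le_t

theorem const_le_rpow_eps : (1000 * (P.invEps : ℝ) ^ 10) ^ 16 ≤ (P.t : ℝ) ^ P.eps := by
  have hN := P.invEps_pos
  have h16 : 16 ≤ 4 ^ (P.L + 1) := by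
    have := Nat.pow_le_pow_right (n := 4) (by norm_num) (Nat.succ_le_succ hP.one_le_L)
    simpa using this
  have h1 : ((1000 * (P.invEps : ℝ) ^ 10) ^ 16) ^ P.invEps ≤ (P.t : ℝ) := by
    have h : ((1000 * P.invEps ^ 10) ^ 16) ^ P.invEps ≤ P.t := by
      refine le_trans ?_ hP.tMin_le
      unfold tMin
      rw [← pow_mul]
      exact Nat.pow_le_pow_right (by positivity) (Nat.mul_le_mul_right _ h16)
    exact_mod_cast h
  have h2 := Real.rpow_le_rpow (by positivity) h1 (z := P.eps) (by unfold eps; positivity)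
  rwa [eps, one_div, Real.pow_rpow_inv_natCast (by positivity) hN.ne', ← one_div, ← eps] at h2

theorem const_le_base : 1000 * P.invEps ^ 10 ≤ P.base := by
  have h := hP.const_le_rpow_eps
  have hN := P.invEps_pos
  have h1 : (1 : ℝ) ≤ 1000 * (P.invEps : ℝ) ^ 10 := by
    have : (1 : ℝ) ≤ (P.invEps : ℝ) ^ 10 := one_le_pow₀ (by exact_mod_cast hN)
    linarith
  have h2 : 1000 * (P.invEps : ℝ) ^ 10 ≤ P.base :=
    (le_self_pow₀ h1 (by norm_num)).trans (h.trans (Nat.le_ceil _))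
  exact_mod_cast h2

theorem base_ge : 1000 ≤ P.base :=
  le_trans (Nat.le_mul_of_pos_right _ (pow_pos P.invEps_pos _)) hP.const_le_base

theorem one_lt_base : 1 < P.base := lt_of_lt_of_le (by norm_num) hP.base_ge

theorem base_pos : 0 < P.base := lt_of_lt_of_le (by norm_num) hP.base_ge

/-- `t ^ ε_i` dominates a high power of the base of the snapping, and hence all polynomials in
`1 / ε`. -/
theorem base_pow_le (i : ℕ) : (P.base : ℝ) ^ 50 ≤ (P.t : ℝ) ^ P.epsLevel i := by
  have ht := hP.one_le_t'
  have hx := hP.const_le_rpow_eps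
  have hN : (1 : ℝ) ≤ (P.invEps : ℝ) ^ 10 := one_le_pow₀ (by exact_mod_cast P.invEps_pos)
  have h2 : (2 : ℝ) ≤ (P.t : ℝ) ^ P.eps := by
    refine le_trans (le_trans ?_ (le_self_pow₀ (n := 16) (a := 1000 * (P.invEps : ℝ) ^ 10) ?_ ?_)) hx
      <;> linarith
  have h3 : (P.base : ℝ) ≤ ((P.t : ℝ) ^ P.eps) ^ 2 := by
    have := Nat.ceil_lt_add_one (a := (P.t : ℝ) ^ P.eps) (by positivity)
    unfold base
    nlinarith
  have h4 : (P.base : ℝ) ^ 50 ≤ ((P.t : ℝ) ^ P.eps) ^ 100 := by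
    calc _ ≤ (((P.t : ℝ) ^ P.eps) ^ 2) ^ 50 := pow_le_pow_left₀ (by positivity) h3 _
      _ = _ := by rw [← pow_mul]
  refine h4.trans ?_
  rw [← Real.rpow_mul_natCast (by positivity)]
  refine Real.rpow_le_rpow_of_exponent_le ht ?_
  have he : 0 ≤ P.eps := by unfold eps; positivity
  unfold epsLevel
  rw [mul_comm]
  refine mul_le_mul_of_nonneg_right ?_ he
  have := pow_le_pow_right₀ (a := (100 : ℝ)) (by norm_num) (Nat.succ_le_succ (Nat.zero_le i))
  simpa using this

theorem one_le_rho : 1 ≤ P.rho := Real.one_le_rpow hP.one_le_t' (by positivity)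

theorem le_base_mul_snap {l : ℕ} : l ≤ P.base * P.snap l := by
  unfold snap
  split_ifs with h
  · simp [h]
  · rw [← pow_succ']
    exact (Nat.lt_pow_succ_log_self hP.one_lt_base l).le

theorem snap_pos {l : ℕ} (h : 0 < l) : 0 < P.snap l := by
  unfold snap
  rw [if_neg h.ne']
  exact pow_pos hP.base_pos _

end Large

theorem t_rpow_epsLevel_succ (i : ℕ) :
    (P.t : ℝ) ^ P.epsLevel (i + 1) = ((P.t : ℝ) ^ P.epsLevel i) ^ 100 := by
  rw [← Real.rpow_mul_natCast (by positivity)]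
  congr 1
  unfold epsLevel
  push_cast
  ring

/-! ### Cliques -/

theorem ED_triangle (x y z : P.Win) : P.ED x z ≤ P.ED x y + P.ED y z := editDist_triangle _ _ _

/-- The hypotheses on the distance threshold and on the estimates of the edit distance. -/
structure Accurate (P : QueryInput S) : Prop where
  pos : 0 < P.Δ
  symm : ∀ x y, P.est x y = P.est y x
  lower : ∀ x y, (P.ED x y : ℝ) ≤ P.est x y
  upper : ∀ x y, P.est x y ≤ P.alpha (P.L - 1) * ((P.ED x y : ℝ) + P.Δ)

namespace Accurate

variable (hE : P.Accurate)
include hE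

theorem est_le_of_ED_le {x w : P.Win} {τ : ℕ} (h : (P.ED x w : ℝ) ≤ 3 * (P.Δ * P.cL ^ τ)) :
    P.est x w ≤ P.Δ * P.cL ^ (τ + 1) := by
  have ha := P.one_le_alpha (P.L - 1)
  have hc := P.hundred_le_cL
  have h1 : 1 ≤ P.cL ^ τ := one_le_pow₀ (by linarith)
  have h2 : P.Δ ≤ P.Δ * P.cL ^ τ := le_mul_of_one_le_right hE.pos.le h1
  have hpos : 0 < P.Δ * P.cL ^ τ := lt_of_lt_of_le hE.pos h2
  calc _ ≤ P.alpha (P.L - 1) * ((P.ED x w : ℝ) + P.Δ) := hE.upper _ _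
    _ ≤ P.alpha (P.L - 1) * (100 * (P.Δ * P.cL ^ τ)) := by gcongr; linarith
    _ = _ := by rw [pow_succ]; nth_rewrite 3 [cL]; ring

theorem ED_le_of_mem {live : Finset P.Win} {x w : P.Win} {τ : ℕ} (h : w ∈ P.clique live x τ) :
    (P.ED x w : ℝ) ≤ P.Δ * P.cL ^ τ := by
  classical
  exact (hE.lower _ _).trans (Finset.mem_filter.1 h).2

theorem ED_le_of_mem' {live : Finset P.Win} {x w : P.Win} {τ : ℕ} (h : w ∈ P.clique live x τ) :
    (P.ED w x : ℝ) ≤ P.Δ * P.cL ^ τ := by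
  classical
  refine (hE.lower _ _).trans ?_
  rw [hE.symm]
  exact (Finset.mem_filter.1 h).2

theorem mem_clique_of_common {live : Finset P.Win} {x y y' v : P.Win} {τ : ℕ}
    (h : x ∈ P.clique live y τ) (h' : x ∈ P.clique live y' τ) (hv : v ∈ P.clique live y' τ) :
    v ∈ P.clique live y (τ + 1) := by
  classical
  refine Finset.mem_filter.2 ⟨(Finset.mem_filter.1 hv).1, hE.est_le_of_ED_le ?_⟩
  have h1 := hE.ED_le_of_mem h
  have h2 := hE.ED_le_of_mem' h'
  have h3 := hE.ED_le_of_mem hv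
  have h4 : (P.ED y v : ℝ) ≤ P.ED y x + (P.ED x y' + P.ED y' v) := by
    exact_mod_cast (ED_triangle y x v).trans (Nat.add_le_add_left (ED_triangle x y' v) _)
  linarith

theorem mem_clique_self {live : Finset P.Win} {y : P.Win} (hy : y ∈ live) {τ : ℕ} :
    y ∈ P.clique live y (τ + 1) := by
  classical
  refine Finset.mem_filter.2 ⟨hy, hE.est_le_of_ED_le ?_⟩
  have : P.ED y y = 0 := Nat.sInf_eq_zero.2 (Or.inl (EditChain.refl _))
  rw [this]
  have := P.hundred_le_cL
  have := hE.pos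
  simp only [Nat.cast_zero]
  positivity

/-- The cliques of the members `x` of a small clique around `y` are sandwiched between two cliques
of `y`. -/
theorem clique_subset_clique {live : Finset P.Win} {x y : P.Win} {τ : ℕ}
    (h : x ∈ P.clique live y τ) : P.clique live y τ ⊆ P.clique live x (τ + 1) := by
  classical
  intro w hw
  refine Finset.mem_filter.2 ⟨(Finset.mem_filter.1 hw).1, hE.est_le_of_ED_le ?_⟩
  have h1 := hE.ED_le_of_mem' h
  have h2 := hE.ED_le_of_mem hw
  have h3 := hE.ED_le_of_mem h
  have h4 : (P.ED x w : ℝ) ≤ P.ED x y + P.ED y w := by exact_mod_cast ED_triangle x y w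
  have : (0 : ℝ) ≤ P.ED y x := by positivity
  linarith

theorem clique_mono (live : Finset P.Win) (y : P.Win) {τ τ' : ℕ} (h : τ ≤ τ') :
    P.clique live y τ ⊆ P.clique live y τ' := by
  classical
  have := P.hundred_le_cL
  exact Finset.monotone_filter_right _ fun w _ hw => le_trans hw
    (mul_le_mul_of_nonneg_left (pow_le_pow_right₀ (by linarith) h) hE.pos.le)

theorem clique_subset_clique' {live : Finset P.Win} {x y : P.Win} {τ : ℕ}
    (h : x ∈ P.clique live y τ) : P.clique live x (τ + 1) ⊆ P.clique live y (τ + 2) := by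
  classical
  intro w hw
  refine Finset.mem_filter.2 ⟨(Finset.mem_filter.1 hw).1, hE.est_le_of_ED_le ?_⟩
  have h1 := hE.ED_le_of_mem hw
  have h2 : (P.ED y x : ℝ) ≤ P.Δ * P.cL ^ (τ + 1) :=
    hE.ED_le_of_mem (hE.clique_mono live y (Nat.le_succ τ) h)
  have h4 : (P.ED y w : ℝ) ≤ P.ED y x + P.ED x w := by exact_mod_cast ED_triangle y x w
  have : (0 : ℝ) ≤ P.ED y x := by positivity
  linarith

end Accurate

/-! ### The matching -/

/-- The hypotheses on the matching: its skew is at most two, and it maps each window to a close one. -/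
structure Mapping.Valid (μ : P.Mapping) : Prop where
  skew : μ.SkewAtMost 2
  close : ∀ a b, μ a = some b → (P.ED (Sum.inl a) (Sum.inr b) : ℝ) ≤ P.Δ

theorem Mapping.Matched.symm {μ : P.Mapping} {y z : P.Win} (h : μ.Matched y z) :
    μ.Matched z y := by
  rcases y with a | b <;> rcases z with a' | b' <;> exact h

theorem Mapping.Matched.onA_ne {μ : P.Mapping} {y z : P.Win} (h : μ.Matched y z) :
    P.onA z = !P.onA y := by
  rcases y with a | b <;> rcases z with a' | b' <;> simp_all [Mapping.Matched, onA]

theorem Mapping.mem_image {μ : P.Mapping} {K : Finset P.Win} {z : P.Win} :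
    z ∈ μ.image K ↔ ∃ y ∈ K, μ.Matched y z := by
  classical
  simp [Mapping.image]

theorem Accurate.mate_mem_clique (hE : P.Accurate) {μ : P.Mapping} (hμ : μ.Valid)
    {live : Finset P.Win} {y z : P.Win} (h : μ.Matched y z) (hz : z ∈ live) {τ : ℕ} :
    z ∈ P.clique live y (τ + 1) := by
  classical
  have hc := P.hundred_le_cL
  have hpos := hE.pos
  have h1 : P.Δ ≤ P.Δ * P.cL ^ τ := le_mul_of_one_le_right hE.pos.le (one_le_pow₀ (by linarith))
  refine Finset.mem_filter.2 ⟨hz, ?_⟩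
  rcases y with a | b <;> rcases z with a' | b'
  · exact h.elim
  · exact hE.est_le_of_ED_le (by have := hμ.close _ _ h; linarith)
  · rw [hE.symm]
    exact hE.est_le_of_ED_le (by have := hμ.close _ _ h; linarith)
  · exact h.elim

/-- The partial involution is single-valued: the lower bound on the skew makes the mapping injective. -/
theorem Mapping.Matched.right_unique {μ : P.Mapping} {y z z' : P.Win}
    (hμ : μ.Valid) (h : μ.Matched y z) (h' : μ.Matched y z') : z = z' := by
  rcases y with a | b <;> rcases z with a₁ | b₁ <;> rcases z' with a₂ | b₂ <;>
    simp only [Mapping.Matched] at h h'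
  · rw [h] at h'
    simp_all
  · have h1 := (hμ.skew _ _ _ _ h h').1
    have hd : (0 : ℝ) < P.d := by exact_mod_cast a₁.pos
    simp only [sub_self, abs_zero, start] at h1
    have h2 : |((a₁ * P.d : ℕ) : ℝ) - ((a₂ * P.d : ℕ) : ℝ)| = 0 :=
      le_antisymm (by linarith) (abs_nonneg _)
    rw [abs_eq_zero, sub_eq_zero, Nat.cast_inj] at h2
    rw [Fin.ext (Nat.eq_of_mul_eq_mul_right a₁.pos h2)]

/-! ### Counting intervals -/

variable (P) in
/-- The interval of length `(t ^ ε) ^ k` that contains the window `w`. -/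
noncomputable def blockOf (w : P.Win) (k : ℕ) : Interval :=
  ⟨P.onA w, k, P.idx w / P.base ^ k⟩

open Classical in
variable (P) in
/-- The intervals of length `(t ^ ε) ^ k`. -/
noncomputable def intervalsAt (k : ℕ) : Finset Interval :=
  Finset.univ.image fun w => P.blockOf w k

theorem exists_idx_eq {u : P.Win} {j : ℕ} (h : j ≤ P.idx u) :
    ∃ v, P.onA v = P.onA u ∧ P.idx v = j := by
  rcases u with a | b
  · exact ⟨Sum.inl ⟨j, lt_of_le_of_lt h a.2⟩, rfl, rfl⟩
  · exact ⟨Sum.inr ⟨j, lt_of_le_of_lt h b.2⟩, rfl, rfl⟩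

theorem idx_lt_t (w : P.Win) : P.idx w < P.t := by
  unfold t
  rw [Fintype.card_sum, Fintype.card_fin, Fintype.card_fin]
  rcases w with a | b
  · exact Nat.lt_of_lt_of_le a.2 (Nat.le_add_right _ _)
  · exact Nat.lt_of_lt_of_le b.2 (Nat.le_add_left _ _)

namespace Large

variable (hP : P.Large)
include hP

theorem mem_scaled {m : ℕ} {I : Interval} {w : P.Win} :
    w ∈ P.scaled m I ↔ P.onA w = I.side ∧
      I.block ≤ P.idx w / P.base ^ I.level + (m - 1) / 2 ∧
      P.idx w / P.base ^ I.level < I.block + 1 + (m - 1) / 2 := by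
  have hb : 0 < P.base ^ I.level := pow_pos hP.base_pos _
  rw [scaled, Finset.mem_filter, Nat.div_lt_iff_lt_mul hb, ← Nat.add_mul_div_right _ _ hb,
    Nat.le_div_iff_mul_le hb]
  simp

theorem mem_scaled_one {I : Interval} {w : P.Win} :
    w ∈ P.scaled 1 I ↔ P.blockOf w I.level = I := by
  rw [hP.mem_scaled]
  rcases I with ⟨s, k, q⟩
  simp only [blockOf, Interval.mk.injEq, true_and]
  refine and_congr_right fun _ => ?_
  simp
  omega

theorem mem_scaled_blockOf (m : ℕ) (w : P.Win) (k : ℕ) : w ∈ P.scaled m (P.blockOf w k) := by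
  rw [hP.mem_scaled]
  refine ⟨rfl, Nat.le_add_right _ _, ?_⟩
  simp only [blockOf]
  omega

theorem blockOf_mem_intervals (w : P.Win) {k : ℕ} (hk : k ≤ P.invEps) :
    P.blockOf w k ∈ P.intervals :=
  ⟨hk, w, hP.mem_scaled_blockOf 1 w k⟩

theorem exists_eq_blockOf {I : Interval} (hI : I ∈ P.intervals) :
    ∃ w k, k ≤ P.invEps ∧ I = P.blockOf w k := by
  obtain ⟨hk, w, hw⟩ := hI
  exact ⟨w, _, hk, (hP.mem_scaled_one.1 hw).symm⟩

theorem scaled_blockOf_subset (m : ℕ) (w : P.Win) {k k' : ℕ} (h : k ≤ k') :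
    P.scaled m (P.blockOf w k) ⊆ P.scaled m (P.blockOf w k') := by
  intro u hu
  rw [hP.mem_scaled] at hu ⊢
  obtain ⟨c, rfl⟩ := Nat.exists_eq_add_of_le h
  have hb : 0 < P.base ^ c := pow_pos hP.base_pos _
  obtain ⟨h1, h2, h3⟩ := hu
  refine ⟨h1, ?_⟩
  simp only [blockOf, pow_add, ← Nat.div_div_eq_div_mul] at h2 h3 ⊢
  generalize P.idx w / P.base ^ k = q at *
  generalize P.idx u / P.base ^ k = r at *
  generalize (m - 1) / 2 = s at *
  have hs : s ≤ s * P.base ^ c := Nat.le_mul_of_pos_right _ hb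
  constructor
  · rw [← Nat.add_mul_div_right _ _ hb]
    exact Nat.div_le_div_right (by omega)
  · have : r / P.base ^ c ≤ q / P.base ^ c + s := by
      rw [← Nat.add_mul_div_right _ _ hb]
      exact Nat.div_le_div_right (by omega)
    omega

open Classical in
theorem card_intervalsAt_filter_le {m : ℕ} (hm : m ≤ 8) (k : ℕ) (w : P.Win) :
    ((P.intervalsAt k).filter fun I => w ∈ P.scaled m I).card ≤ 7 := by
  have hs : (m - 1) / 2 ≤ 3 := by omega
  have hc : (Finset.Ico (P.idx w / P.base ^ k - 3) (P.idx w / P.base ^ k + 4)).card ≤ 7 := by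
    rw [Nat.card_Ico]; omega
  refine le_trans (Finset.card_le_card_of_injOn Interval.block ?_ ?_) hc
  · intro I hI
    obtain ⟨hI1, hI2⟩ := Finset.mem_filter.1 hI
    obtain ⟨u, -, rfl⟩ := Finset.mem_image.1 hI1
    obtain ⟨-, h2, h3⟩ := hP.mem_scaled.1 hI2
    simp only [blockOf] at h2 h3 ⊢
    rw [Finset.mem_coe, Finset.mem_Ico]
    generalize P.idx w / P.base ^ k = q at *
    generalize P.idx u / P.base ^ k = r at *
    omega
  · intro I hI J hJ hIJ
    obtain ⟨hI1, hI2⟩ := Finset.mem_filter.1 hI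
    obtain ⟨u, -, rfl⟩ := Finset.mem_image.1 hI1
    obtain ⟨hJ1, hJ2⟩ := Finset.mem_filter.1 hJ
    obtain ⟨v, -, rfl⟩ := Finset.mem_image.1 hJ1
    have h1 := (hP.mem_scaled.1 hI2).1
    have h2 := (hP.mem_scaled.1 hJ2).1
    simp only [blockOf] at h1 h2 hIJ ⊢
    rw [← h1, ← h2, hIJ]

open Classical in
/-- Each window belongs to at most seven of the scaled intervals of one length. -/
theorem sum_card_inter_scaled_le {m : ℕ} (hm : m ≤ 8) (k : ℕ) (K : Finset P.Win) :
    ∑ I ∈ P.intervalsAt k, (K ∩ P.scaled m I).card ≤ 7 * K.card := by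
  calc _ = ∑ I ∈ P.intervalsAt k, ∑ w ∈ K, if w ∈ P.scaled m I then 1 else 0 := by
        refine Finset.sum_congr rfl fun I _ => ?_
        rw [← Finset.card_filter, Finset.filter_mem_eq_inter]
    _ = ∑ w ∈ K, ((P.intervalsAt k).filter fun I => w ∈ P.scaled m I).card := by
        rw [Finset.sum_comm]
        simp only [Finset.card_filter]
    _ ≤ ∑ w ∈ K, 7 := Finset.sum_le_sum fun w _ => hP.card_intervalsAt_filter_le hm k w
    _ = _ := by rw [Finset.sum_const, smul_eq_mul, mul_comm]

theorem sum_card_inter_scaled_le' {m : ℕ} (hm : m ≤ 8) (k : ℕ) (K : Finset P.Win) :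
    ∑ I ∈ P.intervalsAt k, ((K ∩ P.scaled m I).card : ℝ) ≤ 7 * K.card := by
  exact_mod_cast hP.sum_card_inter_scaled_le hm k K

theorem card_scaled_seven_le (w : P.Win) (k : ℕ) :
    (P.scaled 7 (P.blockOf w k)).card ≤ 7 * P.base ^ k := by
  have hc : (Finset.Ico ((P.idx w / P.base ^ k) * P.base ^ k)
      ((P.idx w / P.base ^ k + 7) * P.base ^ k)).card ≤ 7 * P.base ^ k := by
    rw [Nat.card_Ico, ← Nat.sub_mul]
    simp
  refine le_trans (Finset.card_le_card_of_injOn (fun u => P.idx u + 3 * P.base ^ k) ?_ ?_) hc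
  · intro u hu
    rw [Finset.mem_coe, scaled, Finset.mem_filter] at hu
    simp only [blockOf, add_mul] at hu
    rw [Finset.mem_coe, Finset.mem_Ico]
    simp only [add_mul]
    omega
  · intro u hu v hv huv
    have h1 := (hP.mem_scaled.1 hu).1
    have h2 := (hP.mem_scaled.1 hv).1
    rw [← h2] at h1
    have h3 : P.idx u = P.idx v := Nat.add_right_cancel huv
    rcases u with a | b <;> rcases v with a' | b' <;> simp_all [onA, idx, Fin.ext_iff]

/-- A scaled interval that is not the whole family contains a block of full length, in spite of the
truncation. -/
theorem pow_le_card_scaled_seven {w u : P.Win} {k : ℕ} (h : P.onA u = P.onA w)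
    (hu : u ∉ P.scaled 7 (P.blockOf w k)) :
    P.base ^ k ≤ (P.scaled 7 (P.blockOf w k)).card := by
  have hb : 0 < P.base ^ k := pow_pos hP.base_pos _
  set q := P.idx w / P.base ^ k with hq
  have hmem : ∀ v, P.onA v = P.onA w → P.idx v / P.base ^ k ≤ q + 3 →
      q ≤ P.idx v / P.base ^ k + 3 → v ∈ P.scaled 7 (P.blockOf w k) := by
    intro v h1 h2 h3
    refine hP.mem_scaled.2 ⟨h1, h3, ?_⟩
    simp only [blockOf]
    omega
  obtain ⟨x, hx, hx3⟩ : ∃ x : P.Win, (∃ c, c * P.base ^ k + P.base ^ k ≤ P.idx x + 1 ∧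
      c ≤ q ∧ q ≤ c + 1) ∧ P.onA x = P.onA w := by
    by_cases hle : P.idx u / P.base ^ k ≤ q + 3
    · have h4 : ¬ q ≤ P.idx u / P.base ^ k + 3 := fun h' => hu (hmem u h hle h')
      have hq1 : 1 ≤ q := by
        generalize P.idx u / P.base ^ k = r at *
        omega
      refine ⟨w, ⟨q - 1, ?_, by omega, by omega⟩, rfl⟩
      have h5 : q * P.base ^ k ≤ P.idx w := Nat.div_mul_le_self _ _
      have h6 : (q - 1) * P.base ^ k + P.base ^ k = q * P.base ^ k := by
        rw [← Nat.succ_mul, Nat.succ_eq_add_one, Nat.sub_add_cancel hq1]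
      omega
    · refine ⟨u, ⟨q, ?_, le_rfl, by omega⟩, h⟩
      have h5 : (P.idx u / P.base ^ k) * P.base ^ k ≤ P.idx u := Nat.div_mul_le_self _ _
      have h6 : (q + 1) * P.base ^ k ≤ (P.idx u / P.base ^ k) * P.base ^ k :=
        Nat.mul_le_mul_right _ (by omega)
      rw [add_mul] at h6
      omega
  obtain ⟨c, hc1, hc2, hc3⟩ := hx
  have hex : ∀ j : ℕ, j < P.base ^ k → ∃ v, P.onA v = P.onA x ∧ P.idx v = c * P.base ^ k + j :=
    fun j hj => exists_idx_eq (by omega)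
  choose! f hf1 hf2 using hex
  have hcard := Finset.card_le_card_of_injOn (s := Finset.range (P.base ^ k))
    (t := P.scaled 7 (P.blockOf w k)) f ?_ ?_
  · simpa using hcard
  · intro j hj
    have hj' := Finset.mem_range.1 hj
    have h7 : P.idx (f j) / P.base ^ k = c := by
      rw [hf2 j hj', mul_comm, Nat.mul_add_div hb, Nat.div_eq_of_lt hj', add_zero]
    exact hmem _ ((hf1 j hj').trans hx3) (by omega) (by omega)
  · intro j hj j' hj' hjj
    have h8 := hf2 j (Finset.mem_range.1 hj)
    have h9 := hf2 j' (Finset.mem_range.1 hj')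
    rw [hjj] at h8
    omega

theorem card_scaled_seven_succ_le (w : P.Win) (k : ℕ) :
    (P.scaled 7 (P.blockOf w (k + 1))).card ≤ 7 * P.base * (P.scaled 7 (P.blockOf w k)).card := by
  by_cases h : ∃ u, P.onA u = P.onA w ∧ u ∉ P.scaled 7 (P.blockOf w k)
  · obtain ⟨u, hu, hu'⟩ := h
    calc _ ≤ 7 * P.base ^ (k + 1) := hP.card_scaled_seven_le w (k + 1)
      _ = 7 * P.base * P.base ^ k := by ring
      _ ≤ _ := Nat.mul_le_mul_left _ (hP.pow_le_card_scaled_seven hu hu')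
  · push Not at h
    refine (Finset.card_le_card fun u hu => h u (hP.mem_scaled.1 hu).1).trans ?_
    exact Nat.le_mul_of_pos_left _ (Nat.mul_pos (by norm_num) hP.base_pos)

theorem mem_scaled_invEps {w u : P.Win} (h : P.onA u = P.onA w) :
    u ∈ P.scaled 7 (P.blockOf w P.invEps) := by
  have h0 : ∀ v : P.Win, P.idx v / P.base ^ P.invEps = 0 := fun v =>
    Nat.div_eq_of_lt ((idx_lt_t v).trans_le P.t_le_base_pow)
  refine hP.mem_scaled.2 ⟨h, ?_⟩
  simp [blockOf, h0]

end Large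

/-! ### Windows with decreasing densities -/

theorem mem_decreasing {i : ℕ} {live : Finset P.Win} {y : P.Win} :
    y ∈ P.decreasing i live ↔ y ∈ live ∧ ∀ m ∈ ({1, 7} : Finset ℕ),
      ∀ I ∈ P.intervals, ∀ J ∈ P.intervals,
        y ∈ P.scaled m I → I.level < J.level → P.scaled 1 I ⊆ P.scaled 1 J →
          P.liveDensity live (P.scaled m J) / P.liveDensity live (P.scaled m I) ≤
            (P.t : ℝ) ^ (3 * P.epsLevel i) :=
  @Finset.mem_filter _ _ (_) _ _

theorem rpow_three_mul (i : ℕ) :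
    (P.t : ℝ) ^ (3 * P.epsLevel i) = ((P.t : ℝ) ^ P.epsLevel i) ^ 3 := by
  rw [← Real.rpow_mul_natCast (by positivity), mul_comm]
  norm_num

namespace Large

variable (hP : P.Large)
include hP

theorem pos_rpow (e : ℝ) : 0 < (P.t : ℝ) ^ e :=
  Real.rpow_pos_of_pos (lt_of_lt_of_le one_pos hP.one_le_t') _

/-- For one pair of lengths: the live windows around which the density increases a lot lie in
intervals whose live windows are few compared to those of the longer intervals. -/
theorem sum_card_sparse_le {m : ℕ} (hm : m ≤ 8) {Z : ℝ} (hZ : 0 < Z) (live K : Finset P.Win)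
    (k : ℕ) (s : Finset Interval) (hs : s ⊆ P.intervalsAt k)
    (hsub : ∀ I ∈ s, P.scaled m I ⊆ K)
    (hd : ∀ I ∈ s, Z < P.liveDensity live K / P.liveDensity live (P.scaled m I)) :
    ∑ I ∈ s, ((live ∩ P.scaled m I).card : ℝ) ≤ 7 * Z⁻¹ * (live ∩ K).card := by
  have key : ∀ I ∈ s, ((live ∩ P.scaled m I).card : ℝ) ≤
      Z⁻¹ * P.liveDensity live K * (K ∩ P.scaled m I).card := by
    intro I hI
    have h1 := hd I hI
    have h0 : 0 ≤ P.liveDensity live (P.scaled m I) := by unfold liveDensity; positivity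
    have h2 : 0 < P.liveDensity live (P.scaled m I) := by
      refine lt_of_le_of_ne h0 fun h => ?_
      rw [← h, div_zero] at h1
      linarith
    rw [lt_div_iff₀ h2] at h1
    have h3 : (0 : ℝ) < (P.scaled m I).card := by
      by_contra hc
      have : ((P.scaled m I).card : ℝ) = 0 := le_antisymm (not_lt.1 hc) (by positivity)
      simp [liveDensity, this] at h2
    have h4 : ((live ∩ P.scaled m I).card : ℝ) =
        P.liveDensity live (P.scaled m I) * (P.scaled m I).card := by
      unfold liveDensity; field_simp
    rw [h4, Finset.inter_eq_right.2 (hsub I hI)]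
    refine mul_le_mul_of_nonneg_right ?_ h3.le
    rw [inv_mul_eq_div, le_div_iff₀ hZ]
    linarith
  have hdK : 0 ≤ P.liveDensity live K := by unfold liveDensity; positivity
  calc _ ≤ ∑ I ∈ s, Z⁻¹ * P.liveDensity live K * ((K ∩ P.scaled m I).card : ℝ) :=
        Finset.sum_le_sum key
    _ ≤ ∑ I ∈ P.intervalsAt k, Z⁻¹ * P.liveDensity live K * ((K ∩ P.scaled m I).card : ℝ) :=
        Finset.sum_le_sum_of_subset_of_nonneg hs fun _ _ _ => by positivity
    _ ≤ Z⁻¹ * P.liveDensity live K * (7 * K.card) := by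
        rw [← Finset.mul_sum]
        exact mul_le_mul_of_nonneg_left (hP.sum_card_inter_scaled_le' hm k K) (by positivity)
    _ = 7 * Z⁻¹ * (P.liveDensity live K * K.card) := by ring
    _ ≤ _ := by
        refine mul_le_mul_of_nonneg_left ?_ (by positivity)
        unfold liveDensity
        rcases (Nat.cast_nonneg K.card : (0 : ℝ) ≤ K.card).eq_or_lt with h0 | h0
        · rw [← h0, mul_zero]; positivity
        · rw [div_mul_cancel₀ _ h0.ne']

theorem card_sdiff_decreasing_le_const (i : ℕ) (live : Finset P.Win) :
    ((live \ P.decreasing i live).card : ℝ) ≤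
      98 * ((P.invEps : ℝ) + 1) ^ 2 * (((P.t : ℝ) ^ P.epsLevel i) ^ 3)⁻¹ * live.card := by
  classical
  set Z := ((P.t : ℝ) ^ P.epsLevel i) ^ 3 with hZ
  have hZ0 : 0 < Z := pow_pos (hP.pos_rpow _) _
  set N := P.invEps
  let F : ℕ → Interval → ℕ → Finset Interval := fun m J k => (P.intervalsAt k).filter fun I =>
    P.scaled m I ⊆ P.scaled m J ∧
      Z < P.liveDensity live (P.scaled m J) / P.liveDensity live (P.scaled m I)
  have hcover : live \ P.decreasing i live ⊆ ({1, 7} : Finset ℕ).biUnion fun m =>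
      (Finset.range (N + 1)).biUnion fun k' => (P.intervalsAt k').biUnion fun J =>
        (Finset.range (N + 1)).biUnion fun k => (F m J k).biUnion fun I =>
          live ∩ P.scaled m I := by
    intro y hy
    rw [Finset.mem_sdiff, mem_decreasing] at hy
    obtain ⟨hy, hy'⟩ := hy
    simp only [hy, true_and] at hy'
    push Not at hy'
    obtain ⟨m, hm, I, hI, J, hJ, hyI, hlt, hsub, hd⟩ := hy'
    obtain ⟨hk, w, hw⟩ := hI
    have hI' := hP.mem_scaled_one.1 hw
    have hJ' := hP.mem_scaled_one.1 (hsub hw)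
    simp only [Finset.mem_biUnion, Finset.mem_range]
    refine ⟨m, hm, J.level, Nat.lt_succ_of_le hJ.1, J,
      Finset.mem_image.2 ⟨w, Finset.mem_univ _, hJ'⟩, I.level, Nat.lt_succ_of_le hk, I,
      Finset.mem_filter.2 ⟨Finset.mem_image.2 ⟨w, Finset.mem_univ _, hI'⟩, ?_, ?_⟩,
      Finset.mem_inter.2 ⟨hy, hyI⟩⟩
    · rw [← hI', ← hJ']
      exact hP.scaled_blockOf_subset m w hlt.le
    · rw [hZ, ← rpow_three_mul]
      exact hd
  have h1 : (live \ P.decreasing i live).card ≤ ∑ m ∈ ({1, 7} : Finset ℕ),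
      ∑ k' ∈ Finset.range (N + 1), ∑ J ∈ P.intervalsAt k', ∑ k ∈ Finset.range (N + 1),
        ∑ I ∈ F m J k, (live ∩ P.scaled m I).card := by
    refine (Finset.card_le_card hcover).trans ?_
    refine Finset.card_biUnion_le.trans (Finset.sum_le_sum fun m _ => ?_)
    refine Finset.card_biUnion_le.trans (Finset.sum_le_sum fun k' _ => ?_)
    refine Finset.card_biUnion_le.trans (Finset.sum_le_sum fun J _ => ?_)
    refine Finset.card_biUnion_le.trans (Finset.sum_le_sum fun k _ => ?_)
    exact Finset.card_biUnion_le
  calc ((live \ P.decreasing i live).card : ℝ) ≤ ∑ m ∈ ({1, 7} : Finset ℕ),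
      ∑ k' ∈ Finset.range (N + 1), ∑ J ∈ P.intervalsAt k', ∑ k ∈ Finset.range (N + 1),
        ∑ I ∈ F m J k, ((live ∩ P.scaled m I).card : ℝ) := by exact_mod_cast h1
    _ ≤ ∑ m ∈ ({1, 7} : Finset ℕ), ∑ k' ∈ Finset.range (N + 1),
          ((N : ℝ) + 1) * (7 * Z⁻¹) * (7 * live.card) := by
        refine Finset.sum_le_sum fun m hm => Finset.sum_le_sum fun k' _ => ?_
        have hm8 : m ≤ 8 := by
          rcases Finset.mem_insert.1 hm with rfl | hm
          · norm_num
          · rw [Finset.mem_singleton.1 hm]; norm_num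
        calc _ ≤ ∑ J ∈ P.intervalsAt k',
              ((N : ℝ) + 1) * (7 * Z⁻¹) * ((live ∩ P.scaled m J).card : ℝ) := by
              refine Finset.sum_le_sum fun J _ => ?_
              calc _ ≤ ∑ k ∈ Finset.range (N + 1), 7 * Z⁻¹ * ((live ∩ P.scaled m J).card : ℝ) := by
                    refine Finset.sum_le_sum fun k _ => ?_
                    refine hP.sum_card_sparse_le hm8 hZ0 live _ k _ (Finset.filter_subset _ _) ?_ ?_
                    · exact fun I hI => (Finset.mem_filter.1 hI).2.1
                    · exact fun I hI => (Finset.mem_filter.1 hI).2.2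
                _ = _ := by
                    rw [Finset.sum_const, Finset.card_range, nsmul_eq_mul]
                    push_cast; ring
          _ ≤ _ := by
              rw [← Finset.mul_sum]
              exact mul_le_mul_of_nonneg_left (hP.sum_card_inter_scaled_le' hm8 k' live)
                (by positivity)
    _ = _ := by
        simp only [Finset.sum_const, Finset.card_range, nsmul_eq_mul]
        norm_num
        ring

theorem base_ge_real : (1000 : ℝ) ≤ P.base := by exact_mod_cast hP.base_ge

theorem const_le_base' : 1000 * (P.invEps : ℝ) ^ 10 ≤ P.base := by
  exact_mod_cast hP.const_le_base

/-- Almost all live windows have decreasing densities. This holds for every set of live windows. -/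
theorem card_sdiff_decreasing_le (i : ℕ) (live : Finset P.Win) :
    ((live \ P.decreasing i live).card : ℝ) ≤
      P.base * (((P.t : ℝ) ^ P.epsLevel i) ^ 3)⁻¹ * live.card := by
  refine (hP.card_sdiff_decreasing_le_const i live).trans ?_
  have hX := hP.pos_rpow (P.epsLevel i)
  have hN : (1 : ℝ) ≤ P.invEps := by exact_mod_cast P.invEps_pos
  have h1 : (98 : ℝ) * ((P.invEps : ℝ) + 1) ^ 2 ≤ P.base := by
    refine le_trans ?_ hP.const_le_base'
    have h2 : (P.invEps : ℝ) ^ 2 ≤ (P.invEps : ℝ) ^ 10 := pow_le_pow_right₀ hN (by norm_num)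
    nlinarith
  gcongr

/-! ### The size of the next set of live windows -/

theorem le_base_mul_snap' (l : ℕ) : (l : ℝ) ≤ P.base * P.snap l := by
  exact_mod_cast hP.le_base_mul_snap

theorem card_live_inter_le {live C K : Finset P.Win}
    (h : P.rho ≤ P.relDensity live C K) :
    ((live ∩ K).card : ℝ) * C.card ≤
      P.base ^ 2 * P.rho⁻¹ * live.card * (C ∩ K).card := by
  have hrho : 0 < P.rho := lt_of_lt_of_le one_pos hP.one_le_rho
  have hpos : 0 < P.relDensity live C K := lt_of_lt_of_le hrho h
  have hl : (0 : ℝ) < P.localDensity live C K := by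
    rcases (show 0 ≤ P.localDensity live C K by unfold localDensity; positivity).eq_or_lt with h0 | h0
    · rw [relDensity, ← h0, zero_div] at hpos; exact absurd hpos (lt_irrefl _)
    · exact h0
  have hg : (0 : ℝ) < P.globalDensity live C := by
    rcases (show 0 ≤ P.globalDensity live C by unfold globalDensity; positivity).eq_or_lt with h0 | h0
    · rw [relDensity, ← h0, div_zero] at hpos; exact absurd hpos (lt_irrefl _)
    · exact h0
  rw [relDensity, le_div_iff₀ hg] at h
  unfold localDensity at h hl
  unfold globalDensity at h hg
  set a : ℝ := (P.snap (C ∩ K).card : ℝ)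
  set b : ℝ := (P.snap (live ∩ K).card : ℝ)
  set c : ℝ := (P.snap C.card : ℝ)
  set e : ℝ := (P.snap live.card : ℝ)
  have hb : 0 < b := by
    refine (Nat.cast_nonneg _).lt_of_ne' fun h0 => ?_
    rw [show b = 0 from h0, div_zero] at hl
    exact lt_irrefl _ hl
  have he : 0 < e := by
    refine (Nat.cast_nonneg _).lt_of_ne' fun h0 => ?_
    rw [show e = 0 from h0, div_zero] at hg
    exact lt_irrefl _ hg
  have h1 : P.rho * c * b ≤ a * e := by
    rw [le_div_iff₀ hb, mul_div_assoc', div_mul_eq_mul_div, div_le_iff₀ he] at h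
    exact h
  have ha : a ≤ (C ∩ K).card := Nat.cast_le.2 (P.snap_le _)
  have he' : e ≤ live.card := Nat.cast_le.2 (P.snap_le _)
  have hb' : ((live ∩ K).card : ℝ) ≤ P.base * b := hP.le_base_mul_snap' _
  have hc' : (C.card : ℝ) ≤ P.base * c := hP.le_base_mul_snap' _
  have hc0 : 0 ≤ c := Nat.cast_nonneg _
  calc ((live ∩ K).card : ℝ) * C.card ≤ (P.base * b) * (P.base * c) := by gcongr
    _ = P.base ^ 2 * P.rho⁻¹ * (P.rho * c * b) := by field_simp
    _ ≤ P.base ^ 2 * P.rho⁻¹ * (a * e) := by gcongr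
    _ ≤ P.base ^ 2 * P.rho⁻¹ * ((C ∩ K).card * live.card) := by gcongr
    _ = _ := by ring

/-- The next set of live windows is smaller by a factor of about `ρ`. -/
theorem card_nextLive_le {live C : Finset P.Win} (hne : C.Nonempty) :
    ((P.nextLive live C).card : ℝ) ≤ P.base ^ 3 * P.rho⁻¹ * live.card := by
  classical
  have hrho : 0 < P.rho := lt_of_lt_of_le one_pos hP.one_le_rho
  have hc : (0 : ℝ) < C.card := by exact_mod_cast hne.card_pos
  let F : ℕ → Finset Interval := fun k => (P.intervalsAt k).filter fun I =>
    P.rho ≤ P.relDensity live C (P.scaled 7 I)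
  have hcover : P.nextLive live C ⊆ (Finset.range (P.invEps + 1)).biUnion fun k =>
      (F k).biUnion fun I => live ∩ P.scaled 7 I := by
    intro w hw
    rw [nextLive, Finset.mem_filter] at hw
    obtain ⟨hw, I, hI, hd, hwI⟩ := hw
    obtain ⟨u, k, hk, rfl⟩ := hP.exists_eq_blockOf hI
    simp only [Finset.mem_biUnion, Finset.mem_range]
    exact ⟨k, Nat.lt_succ_of_le hk, _, Finset.mem_filter.2
      ⟨Finset.mem_image.2 ⟨u, Finset.mem_univ _, rfl⟩, hd⟩, Finset.mem_inter.2 ⟨hw, hwI⟩⟩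
  have h1 : (P.nextLive live C).card ≤ ∑ k ∈ Finset.range (P.invEps + 1),
      ∑ I ∈ F k, (live ∩ P.scaled 7 I).card := by
    refine (Finset.card_le_card hcover).trans ?_
    exact Finset.card_biUnion_le.trans (Finset.sum_le_sum fun k _ => Finset.card_biUnion_le)
  have h2 : ∀ k, ∑ I ∈ F k, ((live ∩ P.scaled 7 I).card : ℝ) * C.card ≤
      P.base ^ 2 * P.rho⁻¹ * live.card * (7 * C.card) := by
    intro k
    calc _ ≤ ∑ I ∈ F k, P.base ^ 2 * P.rho⁻¹ * live.card * ((C ∩ P.scaled 7 I).card : ℝ) :=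
          Finset.sum_le_sum fun I hI => hP.card_live_inter_le (Finset.mem_filter.1 hI).2
      _ ≤ ∑ I ∈ P.intervalsAt k,
            P.base ^ 2 * P.rho⁻¹ * live.card * ((C ∩ P.scaled 7 I).card : ℝ) :=
          Finset.sum_le_sum_of_subset_of_nonneg (Finset.filter_subset _ _)
            fun _ _ _ => by positivity
      _ ≤ _ := by
          rw [← Finset.mul_sum]
          exact mul_le_mul_of_nonneg_left (hP.sum_card_inter_scaled_le' (by norm_num) k C)
            (by positivity)
  have hN : (1 : ℝ) ≤ P.invEps := by exact_mod_cast P.invEps_pos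
  have h3 : 7 * ((P.invEps : ℝ) + 1) ≤ P.base := by
    refine le_trans ?_ hP.const_le_base'
    have : (P.invEps : ℝ) ≤ (P.invEps : ℝ) ^ 10 := le_self_pow₀ hN (by norm_num)
    linarith
  refine le_of_mul_le_mul_right ?_ hc
  calc ((P.nextLive live C).card : ℝ) * C.card
      ≤ (∑ k ∈ Finset.range (P.invEps + 1),
          ∑ I ∈ F k, ((live ∩ P.scaled 7 I).card : ℝ)) * C.card := by
        gcongr; exact_mod_cast h1
    _ = ∑ k ∈ Finset.range (P.invEps + 1),
          ∑ I ∈ F k, ((live ∩ P.scaled 7 I).card : ℝ) * C.card := by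
        simp only [Finset.sum_mul]
    _ ≤ ∑ k ∈ Finset.range (P.invEps + 1), P.base ^ 2 * P.rho⁻¹ * live.card * (7 * C.card) :=
        Finset.sum_le_sum fun k _ => h2 k
    _ = (7 * ((P.invEps : ℝ) + 1)) * (P.base ^ 2 * P.rho⁻¹ * live.card * C.card) := by
        rw [Finset.sum_const, Finset.card_range, nsmul_eq_mul]; push_cast; ring
    _ ≤ P.base * (P.base ^ 2 * P.rho⁻¹ * live.card * C.card) := by gcongr
    _ = _ := by ring

end Large

/-! ### Stable thresholds -/

/-- A bounded monotone function on the naturals has a flat step. -/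
theorem exists_flat_step {f : ℕ → ℕ} (hf : Monotone f) {B : ℕ} (hB : ∀ n, f n ≤ B) :
    ∃ j ≤ B, f (2 * j + 1) = f (2 * j + 3) := by
  by_contra! h
  have h1 : ∀ j, j ≤ B + 1 → j ≤ f (2 * j + 1) := by
    intro j
    induction j with
    | zero => intro _; exact Nat.zero_le _
    | succ j ih =>
      intro hj
      have h2 := ih (by omega)
      have h3 : f (2 * j + 1) < f (2 * j + 3) :=
        lt_of_le_of_ne (hf (by omega)) (h j (by omega))
      rw [show 2 * (j + 1) + 1 = 2 * j + 3 by ring]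
      omega
  have := h1 (B + 1) le_rfl
  have := hB (2 * (B + 1) + 1)
  omega

namespace Large

variable (hP : P.Large)
include hP

theorem log_card_le (K : Finset P.Win) : Nat.log P.base K.card ≤ P.invEps := by
  have h : K.card ≤ P.t := by unfold t; exact Finset.card_le_univ K
  calc _ ≤ Nat.log P.base (P.base ^ P.invEps) :=
        Nat.log_mono_right (h.trans P.t_le_base_pow)
    _ = _ := Nat.log_pow hP.one_lt_base _

theorem snap_mono {l l' : ℕ} (h : l ≤ l') : P.snap l ≤ P.snap l' := by
  unfold snap
  split_ifs with h1 h2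
  · exact le_rfl
  · exact Nat.zero_le _
  · omega
  · exact Nat.pow_le_pow_right hP.base_pos (Nat.log_mono_right h)

/-- For a small family of sets, some threshold `σ + 1` is such that the snapped sizes of the traces
of the cliques of `y` on these sets do not change between `σ` and `σ + 2`. -/
theorem exists_stable (hE : P.Accurate) (live : Finset P.Win) (y : P.Win)
    (T : Finset (Finset P.Win)) (hT : T.card ≤ 2 * P.invEps + 3) :
    ∃ σ, 1 ≤ σ ∧ σ + 1 ≤ P.tauMax ∧ ∀ K ∈ T, (P.clique live y σ ∩ K).Nonempty →
      P.snap (P.clique live y σ ∩ K).card = P.snap (P.clique live y (σ + 2) ∩ K).card := by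
  have hmono : ∀ K, ∀ {τ τ' : ℕ}, τ ≤ τ' → Nat.log P.base (P.clique live y τ ∩ K).card ≤
      Nat.log P.base (P.clique live y τ' ∩ K).card := fun K τ τ' h =>
    Nat.log_mono_right (Finset.card_le_card
      (Finset.inter_subset_inter_right (hE.clique_mono live y h)))
  obtain ⟨j, hj, hflat⟩ := exists_flat_step
    (f := fun τ => ∑ K ∈ T, Nat.log P.base (P.clique live y τ ∩ K).card)
    (B := T.card * P.invEps) (fun τ τ' h => Finset.sum_le_sum fun K _ => hmono K h)
    (fun τ => Finset.sum_le_card_nsmul _ _ _ fun K _ => hP.log_card_le _)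
  refine ⟨2 * j + 1, by omega, ?_, ?_⟩
  · have hN := P.invEps_ge
    have h1 : T.card * P.invEps ≤ (2 * P.invEps + 3) * P.invEps := Nat.mul_le_mul_right _ hT
    have h2 : P.invEps ^ 3 = P.invEps ^ 2 * P.invEps := pow_succ _ _
    have h3 : 2 * ((2 * P.invEps + 3) * P.invEps) + 2 ≤ 1000 * P.invEps ^ 3 := by nlinarith
    unfold tauMax
    omega
  · intro K hK hne
    have h1 := (Finset.sum_eq_sum_iff_of_le fun K _ => hmono K (by omega)).1 hflat K hK
    have h2 := hne.mono
      (Finset.inter_subset_inter_right (u := K) (hE.clique_mono live y (Nat.le_add_right (2 * j + 1) 2)))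
    unfold snap
    rw [if_neg hne.card_pos.ne', if_neg h2.card_pos.ne', h1]

/-! ### Relative densities around a good window -/

theorem card_mul_card_le_of_relDensity_lt {live C K : Finset P.Win} (hC : C ⊆ live)
    (hne : (C ∩ K).Nonempty) (h : P.relDensity live C K < P.rho) :
    ((C ∩ K).card : ℝ) * live.card ≤
      P.base ^ 2 * P.rho * C.card * (live ∩ K).card := by
  have ha : (0 : ℝ) < P.snap (C ∩ K).card := Nat.cast_pos.2 (hP.snap_pos hne.card_pos)
  have hb : (0 : ℝ) < P.snap (live ∩ K).card := Nat.cast_pos.2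
    (hP.snap_pos (hne.mono (Finset.inter_subset_inter_right hC)).card_pos)
  have hCne : C.Nonempty := hne.mono Finset.inter_subset_left
  have hc : (0 : ℝ) < P.snap C.card := Nat.cast_pos.2 (hP.snap_pos hCne.card_pos)
  have he : (0 : ℝ) < P.snap live.card := Nat.cast_pos.2 (hP.snap_pos (hCne.mono hC).card_pos)
  have hrho : 0 < P.rho := lt_of_lt_of_le one_pos hP.one_le_rho
  unfold relDensity localDensity globalDensity at h
  have hc' : (P.snap C.card : ℝ) ≤ C.card := Nat.cast_le.2 (P.snap_le _)
  have hb' : (P.snap (live ∩ K).card : ℝ) ≤ (live ∩ K).card := Nat.cast_le.2 (P.snap_le _)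
  have ha' := hP.le_base_mul_snap' (C ∩ K).card
  have he' := hP.le_base_mul_snap' live.card
  set a : ℝ := (P.snap (C ∩ K).card : ℝ)
  set b : ℝ := (P.snap (live ∩ K).card : ℝ)
  set c : ℝ := (P.snap C.card : ℝ)
  set e : ℝ := (P.snap live.card : ℝ)
  have h1 : a * e ≤ P.rho * c * b := by
    rw [div_div_div_eq, div_lt_iff₀ (by positivity)] at h
    linarith
  calc ((C ∩ K).card : ℝ) * live.card ≤ (P.base * a) * (P.base * e) := by gcongr
    _ = P.base ^ 2 * (a * e) := by ring
    _ ≤ P.base ^ 2 * (P.rho * c * b) := by gcongr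
    _ ≤ P.base ^ 2 * (P.rho * C.card * (live ∩ K).card) := by gcongr
    _ = _ := by ring

theorem card_live_inter_succ_le {i : ℕ} {live : Finset P.Win} {w : P.Win}
    (hw : w ∈ P.decreasing i live) {k : ℕ} (hk : k < P.invEps) :
    ((live ∩ P.scaled 7 (P.blockOf w (k + 1))).card : ℝ) ≤
      7 * P.base * ((P.t : ℝ) ^ P.epsLevel i) ^ 3 *
        (live ∩ P.scaled 7 (P.blockOf w k)).card := by
  obtain ⟨hwl, hd⟩ := mem_decreasing.1 hw
  have h := hd 7 (by simp) _ (hP.blockOf_mem_intervals w hk.le) _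
    (hP.blockOf_mem_intervals w (k := k + 1) hk) (hP.mem_scaled_blockOf 7 w k)
    (Nat.lt_succ_self k) (hP.scaled_blockOf_subset 1 w (Nat.le_succ k))
  rw [rpow_three_mul] at h
  have hX := hP.pos_rpow (P.epsLevel i)
  set X := (P.t : ℝ) ^ P.epsLevel i
  have hc := hP.card_scaled_seven_succ_le w k
  unfold liveDensity at h
  have hmem := hP.mem_scaled_blockOf 7 w k
  have hmem' := hP.mem_scaled_blockOf 7 w (k + 1)
  set K := P.scaled 7 (P.blockOf w k)
  set K' := P.scaled 7 (P.blockOf w (k + 1))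
  have h1 : (0 : ℝ) < (live ∩ K).card :=
    Nat.cast_pos.2 (Finset.card_pos.2 ⟨w, Finset.mem_inter.2 ⟨hwl, hmem⟩⟩)
  have h2 : (0 : ℝ) < K.card := Nat.cast_pos.2 (Finset.card_pos.2 ⟨w, hmem⟩)
  have h3 : (0 : ℝ) < K'.card := Nat.cast_pos.2 (Finset.card_pos.2 ⟨w, hmem'⟩)
  have hc' : (K'.card : ℝ) ≤ 7 * P.base * K.card := by exact_mod_cast hc
  rw [div_le_iff₀ (by positivity), mul_div_assoc', div_le_div_iff₀ h3 h2] at h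
  refine le_of_mul_le_mul_right ?_ h2
  calc ((live ∩ K').card : ℝ) * K.card ≤ X ^ 3 * (live ∩ K).card * K'.card := h
    _ ≤ X ^ 3 * (live ∩ K).card * (7 * P.base * K.card) := by gcongr
    _ = _ := by ring

theorem const_mul_le (i : ℕ) : 7 * (P.base : ℝ) ^ 4 ≤ (P.t : ℝ) ^ P.epsLevel i := by
  have hb := hP.base_ge_real
  refine le_trans ?_ (hP.base_pow_le i)
  calc 7 * (P.base : ℝ) ^ 4 ≤ (P.base : ℝ) * (P.base : ℝ) ^ 4 := by gcongr; linarith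
    _ = (P.base : ℝ) ^ 5 := by ring
    _ ≤ _ := pow_le_pow_right₀ (by linarith) (by norm_num)

theorem one_le_X (i : ℕ) : 1 ≤ (P.t : ℝ) ^ P.epsLevel i := by
  have hb := hP.base_ge_real
  have : (1 : ℝ) ≤ P.base ^ 4 := one_le_pow₀ (by linarith)
  linarith [hP.const_mul_le i]

/-- At the longest interval around a window on which a clique has relative density at least `ρ`, the
relative density is not much larger than `ρ`. -/
theorem card_mul_card_le_of_longest {i : ℕ} {live C : Finset P.Win} {w : P.Win}
    (hw : w ∈ P.decreasing i live)
    (hside : (live.card : ℝ) ≤ 2 * (P.t : ℝ) ^ P.epsLevel i *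
      (live.filter fun u => P.onA u = P.onA w).card)
    (hC : C ⊆ live) (hwC : w ∈ C) {k : ℕ} (hk : k ≤ P.invEps)
    (hlast : k < P.invEps → P.relDensity live C (P.scaled 7 (P.blockOf w (k + 1))) < P.rho) :
    P.base * (((C ∩ P.scaled 7 (P.blockOf w k)).card : ℝ) * live.card) ≤
      P.rho * ((P.t : ℝ) ^ P.epsLevel i) ^ 4 * C.card *
        (live ∩ P.scaled 7 (P.blockOf w k)).card := by
  have hX := hP.const_mul_le i
  have hX1 := hP.one_le_X i
  have hb := hP.base_ge_real
  have hrho := hP.one_le_rho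
  rcases hk.lt_or_eq with hk | rfl
  · have h1 := hP.card_mul_card_le_of_relDensity_lt hC
      ⟨w, Finset.mem_inter.2 ⟨hwC, hP.mem_scaled_blockOf 7 w (k + 1)⟩⟩ (hlast hk)
    have h2 := hP.card_live_inter_succ_le hw hk
    have h3 : ((C ∩ P.scaled 7 (P.blockOf w k)).card : ℝ) ≤
        (C ∩ P.scaled 7 (P.blockOf w (k + 1))).card := Nat.cast_le.2 (Finset.card_le_card
          (Finset.inter_subset_inter_left (hP.scaled_blockOf_subset 7 w (Nat.le_succ k))))
    set X := (P.t : ℝ) ^ P.epsLevel i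
    calc _ ≤ P.base * (((C ∩ P.scaled 7 (P.blockOf w (k + 1))).card : ℝ) * live.card) := by gcongr
      _ ≤ P.base * (P.base ^ 2 * P.rho * C.card *
            (live ∩ P.scaled 7 (P.blockOf w (k + 1))).card) := by gcongr
      _ ≤ P.base * (P.base ^ 2 * P.rho * C.card *
            (7 * P.base * X ^ 3 * (live ∩ P.scaled 7 (P.blockOf w k)).card)) := by gcongr
      _ = (7 * P.base ^ 4) * (P.rho * X ^ 3 * C.card *
            (live ∩ P.scaled 7 (P.blockOf w k)).card) := by ring
      _ ≤ X * (P.rho * X ^ 3 * C.card *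
            (live ∩ P.scaled 7 (P.blockOf w k)).card) := by gcongr
      _ = _ := by ring
  -- the longest intervals are the whole families, which have similar numbers of live windows
  · have h1 : (live.filter fun u => P.onA u = P.onA w) ⊆
        live ∩ P.scaled 7 (P.blockOf w P.invEps) := fun u hu =>
      Finset.mem_inter.2 ⟨(Finset.mem_filter.1 hu).1,
        hP.mem_scaled_invEps (Finset.mem_filter.1 hu).2⟩
    have h2 : ((live.filter fun u => P.onA u = P.onA w).card : ℝ) ≤
        (live ∩ P.scaled 7 (P.blockOf w P.invEps)).card :=
      Nat.cast_le.2 (Finset.card_le_card h1)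
    have h3 : ((C ∩ P.scaled 7 (P.blockOf w P.invEps)).card : ℝ) ≤ C.card :=
      Nat.cast_le.2 (Finset.card_le_card Finset.inter_subset_left)
    set X := (P.t : ℝ) ^ P.epsLevel i
    have h4 : 2 * (P.base : ℝ) * X ≤ P.rho * X ^ 4 := by
      have h5 : 2 * (P.base : ℝ) ≤ 7 * P.base ^ 4 := by
        have : (P.base : ℝ) ≤ P.base ^ 4 := le_self_pow₀ (by linarith) (by norm_num)
        linarith
      calc _ ≤ X * X := by gcongr; linarith
        _ = 1 * X ^ 2 := by ring
        _ ≤ P.rho * X ^ 4 := by gcongr; norm_num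
    calc _ ≤ P.base * ((C.card : ℝ) * (2 * X *
          (live ∩ P.scaled 7 (P.blockOf w P.invEps)).card)) := by
          gcongr
          exact hside.trans (by gcongr)
      _ = (2 * P.base * X) * (C.card * (live ∩ P.scaled 7 (P.blockOf w P.invEps)).card) := by ring
      _ ≤ (P.rho * X ^ 4) * (C.card * (live ∩ P.scaled 7 (P.blockOf w P.invEps)).card) := by
          gcongr
      _ = _ := by ring

/-- A window of a small clique lies in a longest interval with relative density at least `ρ`: on the
shortest one the clique has local density one, hence relative density at least `ρ`. -/
theorem exists_longest {live C : Finset P.Win} (hC : C ⊆ live) {w : P.Win} (hw : w ∈ C)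
    (hsmall : ¬ P.IsBig live C) :
    ∃ k ≤ P.invEps, P.rho ≤ P.relDensity live C (P.scaled 7 (P.blockOf w k)) ∧
      (k < P.invEps → P.relDensity live C (P.scaled 7 (P.blockOf w (k + 1))) < P.rho) := by
  classical
  let s := (Finset.range (P.invEps + 1)).filter fun k =>
    P.rho ≤ P.relDensity live C (P.scaled 7 (P.blockOf w k))
  have h0 : 0 ∈ s := by
    refine Finset.mem_filter.2 ⟨Finset.mem_range.2 (Nat.succ_pos _), ?_⟩
    -- at most seven windows are snapped to one, so that the local density is one here
    have hsnap : ∀ K : Finset P.Win, w ∈ K → K ⊆ P.scaled 7 (P.blockOf w 0) →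
        P.snap K.card = 1 := by
      intro K hwK hK
      have h1 := (Finset.card_le_card hK).trans (hP.card_scaled_seven_le w 0)
      rw [pow_zero] at h1
      have hb := hP.base_ge
      unfold snap
      rw [if_neg (Finset.card_pos.2 ⟨w, hwK⟩).ne', Nat.log_of_lt (by omega), pow_zero]
    have hmem := hP.mem_scaled_blockOf 7 w 0
    unfold relDensity localDensity
    rw [hsnap _ (Finset.mem_inter.2 ⟨hw, hmem⟩) Finset.inter_subset_right,
      hsnap _ (Finset.mem_inter.2 ⟨hC hw, hmem⟩) Finset.inter_subset_right]
    have hg : 0 < P.globalDensity live C := by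
      have h1 := hP.snap_pos (Finset.card_pos.2 ⟨w, hw⟩)
      have h2 := hP.snap_pos (Finset.card_pos.2 ⟨w, hC hw⟩)
      unfold globalDensity
      positivity
    rw [Nat.cast_one, div_one, one_div, le_inv_comm₀ (lt_of_lt_of_le one_pos hP.one_le_rho) hg]
    exact not_lt.1 hsmall
  have hmax := s.max'_mem ⟨0, h0⟩
  obtain ⟨h1, h2⟩ := Finset.mem_filter.1 hmax
  refine ⟨s.max' ⟨0, h0⟩, Nat.lt_succ_iff.1 (Finset.mem_range.1 h1), h2, fun hlt => ?_⟩
  by_contra hc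
  have h3 : s.max' ⟨0, h0⟩ + 1 ∈ s :=
    Finset.mem_filter.2 ⟨Finset.mem_range.2 (Nat.succ_lt_succ hlt), not_lt.1 hc⟩
  exact absurd (s.le_max' _ h3) (by omega)

end Large

variable (P) in
/-- The distance between the starting positions of consecutive windows of the family of `w`. -/
def spacing (w : P.Win) : ℕ := if P.onA w then P.d else P.γ

variable (P) in
/-- The situation around an edge `{v, u}` at one of its ends `y`, for the threshold `σ + 1`. No clique
around a member `x` of the clique `C(y, σ)` is big; it is relatively dense around `v`, and
around `u` on an interval that is physically at least as long; and its relative density on the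
interval around `v` is not much larger than `ρ`. -/
structure Spread (i : ℕ) (live : Finset P.Win) (σ k : ℕ) (y v u : P.Win) : Prop where
  not_big : ∀ x ∈ P.clique live y σ, ¬ P.IsBig live (P.clique live x (σ + 1))
  dense : ∀ x ∈ P.clique live y σ,
    P.rho ≤ P.relDensity live (P.clique live x (σ + 1)) (P.scaled 7 (P.blockOf v k))
  dense_mate : ∃ k' ≤ P.invEps, P.spacing v * P.base ^ k ≤ P.spacing u * P.base ^ k' ∧
    ∀ x ∈ P.clique live y σ,
      P.rho ≤ P.relDensity live (P.clique live x (σ + 1)) (P.scaled 7 (P.blockOf u k'))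
  card_le : ((P.clique live y (σ + 1) ∩ P.scaled 7 (P.blockOf v k)).card : ℝ) * live.card ≤
    P.rho * ((P.t : ℝ) ^ P.epsLevel i) ^ 4 * (P.clique live y σ).card *
      (live ∩ P.scaled 7 (P.blockOf v k)).card

theorem clique_subset (live : Finset P.Win) (x : P.Win) (τ : ℕ) : P.clique live x τ ⊆ live :=
  Finset.filter_subset _ _

/-- For a good window there is a threshold for which the cliques of nearby windows are either all
big or all small with the situation of `Spread` at one of the ends of the edge. -/
theorem Large.big_or_spread (hP : P.Large) (hE : P.Accurate) {μ : P.Mapping} (hμ : μ.Valid)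
    {i : ℕ} {live : Finset P.Win} {y z : P.Win}
    (hy : y ∈ P.decreasing i live) (hz : z ∈ P.decreasing i live) (hyz : μ.Matched y z)
    (hside : ∀ s : Bool, (live.card : ℝ) ≤ 2 * (P.t : ℝ) ^ P.epsLevel i *
      (live.filter fun u => P.onA u = s).card) :
    ∃ σ, 1 ≤ σ ∧ σ + 1 ≤ P.tauMax ∧
      (((∀ x ∈ P.clique live y σ, P.IsBig live (P.clique live x (σ + 1))) ∧
          P.rho⁻¹ * live.card ≤ P.base * (P.clique live y σ).card) ∨
        ∃ k ≤ P.invEps, P.Spread i live σ k y y z ∨ P.Spread i live σ k y z y) := by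
  classical
  have hyl := (mem_decreasing.1 hy).1
  have hzl := (mem_decreasing.1 hz).1
  let T : Finset (Finset P.Win) := insert Finset.univ
    (((Finset.range (P.invEps + 1)).image fun k => P.scaled 7 (P.blockOf y k)) ∪
      ((Finset.range (P.invEps + 1)).image fun k => P.scaled 7 (P.blockOf z k)))
  have hT : T.card ≤ 2 * P.invEps + 3 := by
    have h1 : ((Finset.range (P.invEps + 1)).image fun k => P.scaled 7 (P.blockOf y k)).card ≤ _ :=
      Finset.card_image_le
    have h2 : ((Finset.range (P.invEps + 1)).image fun k => P.scaled 7 (P.blockOf z k)).card ≤ _ :=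
      Finset.card_image_le
    rw [Finset.card_range] at h1 h2
    refine (Finset.card_insert_le _ _).trans ?_
    have := Finset.card_union_le
      ((Finset.range (P.invEps + 1)).image fun k => P.scaled 7 (P.blockOf y k))
      ((Finset.range (P.invEps + 1)).image fun k => P.scaled 7 (P.blockOf z k))
    omega
  obtain ⟨σ, hσ, hσ', hstab⟩ := hP.exists_stable hE live y T hT
  refine ⟨σ, hσ, hσ', ?_⟩
  obtain ⟨τ, rfl⟩ : ∃ τ, σ = τ + 1 := ⟨σ - 1, by omega⟩
  have hyC : y ∈ P.clique live y (τ + 1) := hE.mem_clique_self hyl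
  have hzC : z ∈ P.clique live y (τ + 1) := hE.mate_mem_clique hμ hyz hzl
  have hyT : ∀ {k}, k ≤ P.invEps → P.scaled 7 (P.blockOf y k) ∈ T := fun {k} hk =>
    Finset.mem_insert_of_mem (Finset.mem_union_left _
      (Finset.mem_image.2 ⟨k, Finset.mem_range.2 (Nat.lt_succ_of_le hk), rfl⟩))
  have hzT : ∀ {k}, k ≤ P.invEps → P.scaled 7 (P.blockOf z k) ∈ T := fun {k} hk =>
    Finset.mem_insert_of_mem (Finset.mem_union_right _
      (Finset.mem_image.2 ⟨k, Finset.mem_range.2 (Nat.lt_succ_of_le hk), rfl⟩))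
  -- all cliques between the smallest and the largest one have the same snapped traces
  have hsnap : ∀ K ∈ T, (P.clique live y (τ + 1) ∩ K).Nonempty → ∀ C : Finset P.Win,
      P.clique live y (τ + 1) ⊆ C → C ⊆ P.clique live y (τ + 1 + 2) →
      P.snap (C ∩ K).card = P.snap (P.clique live y (τ + 1) ∩ K).card := by
    intro K hK hne C h1 h2
    refine le_antisymm ?_ (hP.snap_mono (Finset.card_le_card (Finset.inter_subset_inter_right h1)))
    rw [hstab K hK hne]
    exact hP.snap_mono (Finset.card_le_card (Finset.inter_subset_inter_right h2))
  have hsnap' : ∀ C : Finset P.Win, P.clique live y (τ + 1) ⊆ C →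
      C ⊆ P.clique live y (τ + 1 + 2) → P.snap C.card = P.snap (P.clique live y (τ + 1)).card := by
    intro C h1 h2
    have := hsnap Finset.univ (Finset.mem_insert_self _ _) ⟨y, by simpa using hyC⟩ C h1 h2
    simpa using this
  have hC1 : P.clique live y (τ + 1) ⊆ P.clique live y (τ + 1 + 1) :=
    hE.clique_mono _ _ (by omega)
  have hC2 : P.clique live y (τ + 1 + 1) ⊆ P.clique live y (τ + 1 + 2) :=
    hE.clique_mono _ _ (by omega)
  have hg : ∀ x ∈ P.clique live y (τ + 1), P.globalDensity live (P.clique live x (τ + 1 + 1)) =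
      P.globalDensity live (P.clique live y (τ + 1 + 1)) := by
    intro x hx
    unfold globalDensity
    rw [hsnap' _ (hE.clique_subset_clique hx) (hE.clique_subset_clique' hx), hsnap' _ hC1 hC2]
  have hrel : ∀ x ∈ P.clique live y (τ + 1), ∀ K ∈ T, (P.clique live y (τ + 1) ∩ K).Nonempty →
      P.relDensity live (P.clique live x (τ + 1 + 1)) K =
        P.relDensity live (P.clique live y (τ + 1 + 1)) K := by
    intro x hx K hK hne
    unfold relDensity localDensity
    rw [hg x hx, hsnap K hK hne _ (hE.clique_subset_clique hx) (hE.clique_subset_clique' hx),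
      hsnap K hK hne _ hC1 hC2]
  have hrho : 0 < P.rho := lt_of_lt_of_le one_pos hP.one_le_rho
  by_cases hbig : P.IsBig live (P.clique live y (τ + 1 + 1))
  · refine Or.inl ⟨fun x hx => ?_, ?_⟩
    · unfold IsBig
      rw [hg x hx]
      exact hbig
    · have h1 : P.rho⁻¹ < _ := hbig
      have hl : (0 : ℝ) < P.snap live.card :=
        Nat.cast_pos.2 (hP.snap_pos (Finset.card_pos.2 ⟨y, hyl⟩))
      rw [globalDensity, hsnap' _ hC1 hC2, lt_div_iff₀ hl] at h1
      calc P.rho⁻¹ * live.card ≤ P.rho⁻¹ * (P.base * P.snap live.card) := by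
            gcongr; exact hP.le_base_mul_snap' _
        _ = P.base * (P.rho⁻¹ * P.snap live.card) := by ring
        _ ≤ P.base * P.snap (P.clique live y (τ + 1)).card := by gcongr
        _ ≤ _ := by gcongr; exact P.snap_le _
  · right
    have hCcard : ((P.clique live y (τ + 1 + 1)).card : ℝ) ≤
        P.base * (P.clique live y (τ + 1)).card := by
      refine (hP.le_base_mul_snap' _).trans ?_
      rw [hsnap' _ hC1 hC2]
      gcongr
      exact P.snap_le _
    have hbpos : (0 : ℝ) < P.base := Nat.cast_pos.2 hP.base_pos
    have hcard : ∀ w ∈ P.decreasing i live, w ∈ P.clique live y (τ + 1) → ∀ k ≤ P.invEps,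
        (k < P.invEps → P.relDensity live (P.clique live y (τ + 1 + 1))
          (P.scaled 7 (P.blockOf w (k + 1))) < P.rho) →
        ((P.clique live y (τ + 1 + 1) ∩ P.scaled 7 (P.blockOf w k)).card : ℝ) * live.card ≤
          P.rho * ((P.t : ℝ) ^ P.epsLevel i) ^ 4 * (P.clique live y (τ + 1)).card *
            (live ∩ P.scaled 7 (P.blockOf w k)).card := by
      intro w hw hwC k hk hlast
      have h1 := hP.card_mul_card_le_of_longest hw (hside _) (clique_subset live y _) (hC1 hwC)
        hk hlast
      refine le_of_mul_le_mul_left (h1.trans ?_) hbpos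
      have hX := (hP.pos_rpow (P.epsLevel i)).le
      calc _ ≤ P.rho * ((P.t : ℝ) ^ P.epsLevel i) ^ 4 * (P.base * (P.clique live y (τ + 1)).card) *
            (live ∩ P.scaled 7 (P.blockOf w k)).card := by gcongr
        _ = _ := by ring
    obtain ⟨ky, hky, hdy, hly⟩ := hP.exists_longest (clique_subset live y _) (hC1 hyC) hbig
    obtain ⟨kz, hkz, hdz, hlz⟩ := hP.exists_longest (clique_subset live y _) (hC1 hzC) hbig
    have hnb : ∀ x ∈ P.clique live y (τ + 1), ¬ P.IsBig live (P.clique live x (τ + 1 + 1)) := by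
      intro x hx
      unfold IsBig
      rw [hg x hx]
      exact hbig
    have hdy' : ∀ x ∈ P.clique live y (τ + 1), P.rho ≤
        P.relDensity live (P.clique live x (τ + 1 + 1)) (P.scaled 7 (P.blockOf y ky)) := by
      intro x hx
      rwa [hrel x hx _ (hyT hky) ⟨y, Finset.mem_inter.2 ⟨hyC, hP.mem_scaled_blockOf _ _ _⟩⟩]
    have hdz' : ∀ x ∈ P.clique live y (τ + 1), P.rho ≤
        P.relDensity live (P.clique live x (τ + 1 + 1)) (P.scaled 7 (P.blockOf z kz)) := by
      intro x hx
      rwa [hrel x hx _ (hzT hkz) ⟨z, Finset.mem_inter.2 ⟨hzC, hP.mem_scaled_blockOf _ _ _⟩⟩]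
    rcases le_total (P.spacing y * P.base ^ ky) (P.spacing z * P.base ^ kz) with hle | hle
    · exact ⟨ky, hky, Or.inl ⟨hnb, hdy', ⟨kz, hkz, hle, hdz'⟩, hcard y hy hyC ky hky hly⟩⟩
    · exact ⟨kz, hkz, Or.inr ⟨hnb, hdz', ⟨ky, hky, hle, hdy'⟩, hcard z hz hzC kz hkz hlz⟩⟩

/-! ### Neighbouring edges -/

theorem start_eq (w : P.Win) : P.start w = P.idx w * P.spacing w := by
  rcases w with a | b <;> simp [start, idx, spacing, onA]

theorem spacing_pos (hγ : 1 ≤ P.γ) (w : P.Win) : 0 < P.spacing w := by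
  rcases w with a | b
  · exact a.pos
  · exact hγ

theorem spacing_eq_of_onA_eq {w w' : P.Win} (h : P.onA w = P.onA w') :
    P.spacing w = P.spacing w' := by
  unfold spacing; rw [h]

theorem Mapping.Valid.abs_start_sub_le {μ : P.Mapping} (hμ : μ.Valid) {v u v' u' : P.Win}
    (h : μ.Matched v u) (h' : μ.Matched v' u') (hv : P.onA v = P.onA v') :
    |(P.start u : ℝ) - P.start u'| ≤ 2 * |(P.start v : ℝ) - P.start v'| := by
  rcases v with a | b <;> rcases u with a₁ | b₁ <;> rcases v' with a' | b' <;>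
    rcases u' with a₂ | b₂ <;> simp only [Mapping.Matched, onA, reduceCtorEq] at h h' hv
  · exact (hμ.skew _ _ _ _ h h').2
  · have := (hμ.skew _ _ _ _ h h').1
    linarith

/-- As the skew is at most two, an interval that is physically at least as long as a block and lies
around the mate of one window of the block contains, after scaling, the mates of the whole block. -/
theorem Large.mate_mem_scaled (hP : P.Large) (hγ : 1 ≤ P.γ) {μ : P.Mapping} (hμ : μ.Valid)
    {v u v₀ u₀ : P.Win} (h : μ.Matched v u) (h₀ : μ.Matched v₀ u₀) {k k' : ℕ}
    (hv : P.blockOf v k = P.blockOf v₀ k)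
    (hle : P.spacing v₀ * P.base ^ k ≤ P.spacing u₀ * P.base ^ k') :
    u ∈ P.scaled 7 (P.blockOf u₀ k') := by
  simp only [blockOf, Interval.mk.injEq, true_and] at hv
  obtain ⟨hside, hq⟩ := hv
  have hside' : P.onA u = P.onA u₀ := by rw [h.onA_ne, h₀.onA_ne, hside]
  have hb : 0 < P.base ^ k := pow_pos hP.base_pos _
  have hb' : 0 < P.base ^ k' := pow_pos hP.base_pos _
  have h1 := hμ.abs_start_sub_le h h₀ hside
  rw [start_eq, start_eq, start_eq, start_eq, spacing_eq_of_onA_eq hside,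
    spacing_eq_of_onA_eq hside'] at h1
  push_cast at h1
  rw [← sub_mul, ← sub_mul, abs_mul, abs_mul, Nat.abs_cast, Nat.abs_cast] at h1
  have h2 : |(P.idx v : ℝ) - P.idx v₀| ≤ (P.base ^ k : ℕ) := by
    have e1 := Nat.div_add_mod (P.idx v) (P.base ^ k)
    have e2 := Nat.div_add_mod (P.idx v₀) (P.base ^ k)
    have e3 := Nat.mod_lt (P.idx v) hb
    have e4 := Nat.mod_lt (P.idx v₀) hb
    rw [hq] at e1
    generalize P.base ^ k * (P.idx v₀ / P.base ^ k) = Q at e1 e2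
    generalize P.idx v % P.base ^ k = p at *
    generalize P.idx v₀ % P.base ^ k = p₀ at *
    have e5 : P.idx v ≤ P.idx v₀ + P.base ^ k := by omega
    have e6 : P.idx v₀ ≤ P.idx v + P.base ^ k := by omega
    have e5' : (P.idx v : ℝ) ≤ P.idx v₀ + (P.base ^ k : ℕ) := by exact_mod_cast e5
    have e6' : (P.idx v₀ : ℝ) ≤ P.idx v + (P.base ^ k : ℕ) := by exact_mod_cast e6
    rw [abs_le]
    constructor <;> linarith
  have hsu : (0 : ℝ) < P.spacing u₀ := Nat.cast_pos.2 (spacing_pos hγ u₀)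
  have hle' : (P.spacing v₀ : ℝ) * (P.base ^ k : ℕ) ≤ P.spacing u₀ * (P.base ^ k' : ℕ) := by
    exact_mod_cast hle
  have h3 : |(P.idx u : ℝ) - P.idx u₀| ≤ 2 * (P.base ^ k' : ℕ) := by
    refine le_of_mul_le_mul_right ?_ hsu
    calc _ ≤ 2 * (|(P.idx v : ℝ) - P.idx v₀| * P.spacing v₀) := h1
      _ ≤ 2 * ((P.base ^ k : ℕ) * P.spacing v₀) := by gcongr
      _ = 2 * (P.spacing v₀ * (P.base ^ k : ℕ)) := by ring
      _ ≤ 2 * (P.spacing u₀ * (P.base ^ k' : ℕ)) := by gcongr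
      _ = _ := by ring
  rw [abs_le] at h3
  have h4 : P.idx u ≤ P.idx u₀ + 2 * P.base ^ k' := by
    have : (P.idx u : ℝ) ≤ P.idx u₀ + 2 * (P.base ^ k' : ℕ) := by linarith
    exact_mod_cast this
  have h5 : P.idx u₀ ≤ P.idx u + 2 * P.base ^ k' := by
    have : (P.idx u₀ : ℝ) ≤ P.idx u + 2 * (P.base ^ k' : ℕ) := by linarith
    exact_mod_cast this
  have h6 := Nat.div_le_div_right (c := P.base ^ k') h4
  have h7 := Nat.div_le_div_right (c := P.base ^ k') h5
  rw [Nat.add_mul_div_right _ _ hb'] at h6 h7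
  refine hP.mem_scaled.2 ⟨hside', ?_⟩
  simp only [blockOf]
  omega

open Classical in
variable (P) in
/-- The live windows `x` such that the choice of `x` and the threshold `σ + 1` leads to a child node
at which both `y` and `z` are live. -/
noncomputable def edgeHits (live : Finset P.Win) (σ : ℕ) (y z : P.Win) : Finset P.Win :=
  live.filter fun x => ¬ P.IsBig live (P.clique live x (σ + 1)) ∧
    y ∈ P.nextLive live (P.clique live x (σ + 1)) ∧ z ∈ P.nextLive live (P.clique live x (σ + 1))

theorem edgeHits_comm (live : Finset P.Win) (σ : ℕ) (y z : P.Win) :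
    P.edgeHits live σ y z = P.edgeHits live σ z y := by
  classical
  unfold edgeHits
  congr 1
  ext x
  rw [and_comm (a := y ∈ _)]

theorem mem_nextLive {live C : Finset P.Win} {w : P.Win} :
    w ∈ P.nextLive live C ↔ w ∈ live ∧
      ∃ I ∈ P.intervals, P.rho ≤ P.relDensity live C (P.scaled 7 I) ∧ w ∈ P.scaled 7 I :=
  @Finset.mem_filter _ _ (_) _ _

/-- All edges next to the edge of `y₀` profit from the choice of a window in the clique of `y₀`. -/
theorem Large.clique_subset_edgeHits (hP : P.Large) (hγ : 1 ≤ P.γ) {μ : P.Mapping}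
    (hμ : μ.Valid) {i : ℕ} {live : Finset P.Win} {v u y₀ v₀ u₀ : P.Win} (hv : v ∈ live)
    (hu : u ∈ live) (h : μ.Matched v u) (h₀ : μ.Matched v₀ u₀) {σ k : ℕ} (hk : k ≤ P.invEps)
    (hs : P.Spread i live σ k y₀ v₀ u₀) (hb : P.blockOf v k = P.blockOf v₀ k) :
    P.clique live y₀ σ ⊆ P.edgeHits live σ v u := by
  classical
  intro x hx
  obtain ⟨k', hk', hle, hd'⟩ := hs.dense_mate
  refine Finset.mem_filter.2 ⟨clique_subset _ _ _ hx, hs.not_big x hx, mem_nextLive.2 ⟨hv, ?_⟩,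
    mem_nextLive.2 ⟨hu, ?_⟩⟩
  · refine ⟨_, hP.blockOf_mem_intervals v₀ hk, hs.dense x hx, ?_⟩
    rw [← hb]
    exact hP.mem_scaled_blockOf _ _ _
  · exact ⟨_, hP.blockOf_mem_intervals u₀ hk', hd' x hx, hP.mate_mem_scaled hγ hμ h h₀ hb hle⟩

/-- The heart of the counting argument. Among the good edges `{v y, u y}` in the situation of `Spread`
whose end `v y` lies in one block, take a maximal family with disjoint cliques. The slightly larger
cliques cover all these edges, and none of them is much denser than `ρ` on the block, so that the
disjoint cliques together contain about a `1 / ρ` fraction of the live windows, unless the edges are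
few; and each window in these cliques leads to a child at which all these edges are live. -/
theorem Large.card_spread_block_le (hP : P.Large) (hE : P.Accurate) (hγ : 1 ≤ P.γ)
    {μ : P.Mapping} (hμ : μ.Valid) {i : ℕ} {live : Finset P.Win} {σ k : ℕ} (hk : k ≤ P.invEps)
    (v u : P.Win → P.Win) {η : ℝ} (hη : 0 ≤ η) (E : Finset P.Win)
    (hmem : ∀ y ∈ E, y ∈ P.clique live y σ ∧ v y ∈ P.clique live y σ ∧ u y ∈ live)
    (hvu : ∀ y ∈ E, μ.Matched (v y) (u y)) (hinj : Set.InjOn v E)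
    (hs : ∀ y ∈ E, P.Spread i live σ k y (v y) (u y)) {w : P.Win}
    (hw : ∀ y ∈ E, P.blockOf (v y) k = P.blockOf w k)
    (hfew : ∀ y ∈ E, ((P.edgeHits live σ (v y) (u y)).card : ℝ) ≤ η * live.card) :
    (E.card : ℝ) ≤ P.rho * ((P.t : ℝ) ^ P.epsLevel i) ^ 4 * η *
      (live ∩ P.scaled 7 (P.blockOf w k)).card := by
  classical
  set X := (P.t : ℝ) ^ P.epsLevel i
  have hX : 0 < X := hP.pos_rpow _
  have hrho : 0 < P.rho := lt_of_lt_of_le one_pos hP.one_le_rho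
  set K := P.scaled 7 (P.blockOf w k) with hK
  obtain ⟨F, hF, hmax⟩ := Finset.exists_max_image
    (E.powerset.filter fun F : Finset P.Win => (F : Set P.Win).PairwiseDisjoint fun y => P.clique live y σ)
    Finset.card ⟨∅, by simp⟩
  obtain ⟨hFE, hdis⟩ := Finset.mem_filter.1 hF
  rw [Finset.mem_powerset] at hFE
  -- otherwise `y` could be added to the family
  have hmeet : ∀ y ∈ E, ∃ y' ∈ F, ¬ Disjoint (P.clique live y' σ) (P.clique live y σ) := by
    intro y hy
    by_contra! hc
    have hyF : y ∉ F := fun h =>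
      Finset.disjoint_left.1 (hc y h) (hmem y hy).1 (hmem y hy).1
    have h1 := hmax (insert y F) (Finset.mem_filter.2
      ⟨Finset.mem_powerset.2 (Finset.insert_subset hy hFE), by
        rw [Finset.coe_insert, Set.pairwiseDisjoint_insert]
        exact ⟨hdis, fun j hj _ => (hc j hj).symm⟩⟩)
    rw [Finset.card_insert_of_notMem hyF] at h1
    omega
  have hcov : E.card ≤ ∑ y ∈ F, (P.clique live y (σ + 1) ∩ K).card := by
    refine le_trans (Finset.card_le_card_of_injOn v ?_ hinj)
      (Finset.card_biUnion_le (s := F) (t := fun y => P.clique live y (σ + 1) ∩ K))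
    intro y hy
    obtain ⟨y', hy', hnd⟩ := hmeet y hy
    obtain ⟨x, hx', hx⟩ := Finset.not_disjoint_iff.1 hnd
    refine Finset.mem_biUnion.2 ⟨y', hy', Finset.mem_inter.2
      ⟨hE.mem_clique_of_common hx' hx (hmem y hy).2.1, ?_⟩⟩
    rw [hK, ← hw y hy]
    exact hP.mem_scaled_blockOf _ _ _
  have hunion : ∑ y ∈ F, (P.clique live y σ).card = (F.biUnion fun y => P.clique live y σ).card :=
    (Finset.card_biUnion hdis).symm
  rcases E.eq_empty_or_nonempty with rfl | ⟨y, hy⟩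
  · simp only [Finset.card_empty, Nat.cast_zero]; positivity
  · have hlive : (0 : ℝ) < live.card :=
      Nat.cast_pos.2 (Finset.card_pos.2 ⟨y, clique_subset _ _ _ (hmem y hy).1⟩)
    have hsub : (F.biUnion fun y => P.clique live y σ) ⊆ P.edgeHits live σ (v y) (u y) := by
      refine Finset.biUnion_subset.2 fun j hj => ?_
      refine hP.clique_subset_edgeHits hγ hμ (clique_subset _ _ _ (hmem y hy).2.1) (hmem y hy).2.2
        (hvu y hy) (hvu j (hFE hj)) hk (hs j (hFE hj)) ?_
      rw [hw y hy, hw j (hFE hj)]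
    have h1 : ((F.biUnion fun y => P.clique live y σ).card : ℝ) ≤ η * live.card :=
      (Nat.cast_le.2 (Finset.card_le_card hsub)).trans (hfew y hy)
    refine le_of_mul_le_mul_right ?_ hlive
    calc (E.card : ℝ) * live.card
        ≤ (∑ y ∈ F, ((P.clique live y (σ + 1) ∩ K).card : ℝ)) * live.card := by
          gcongr; exact_mod_cast hcov
      _ = ∑ y ∈ F, ((P.clique live y (σ + 1) ∩ K).card : ℝ) * live.card := Finset.sum_mul _ _ _
      _ ≤ ∑ y ∈ F, P.rho * X ^ 4 * (P.clique live y σ).card * (live ∩ K).card := by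
          refine Finset.sum_le_sum fun j hj => ?_
          have := (hs j (hFE hj)).card_le
          rwa [hw j (hFE hj)] at this
      _ = P.rho * X ^ 4 * (live ∩ K).card * ∑ y ∈ F, ((P.clique live y σ).card : ℝ) := by
          rw [Finset.mul_sum]
          exact Finset.sum_congr rfl fun _ _ => by ring
      _ = P.rho * X ^ 4 * (live ∩ K).card * (F.biUnion fun y => P.clique live y σ).card := by
          rw [← hunion]; push_cast; rfl
      _ ≤ P.rho * X ^ 4 * (live ∩ K).card * (η * live.card) := by gcongr
      _ = _ := by ring

/-- The edges in the situation of `Spread` which few choices lead to are few. -/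
theorem Large.card_spread_le (hP : P.Large) (hE : P.Accurate) (hγ : 1 ≤ P.γ)
    {μ : P.Mapping} (hμ : μ.Valid) {i : ℕ} {live : Finset P.Win} {σ k : ℕ} (hk : k ≤ P.invEps)
    (v u : P.Win → P.Win) {η : ℝ} (hη : 0 ≤ η) (E : Finset P.Win)
    (hmem : ∀ y ∈ E, y ∈ P.clique live y σ ∧ v y ∈ P.clique live y σ ∧ u y ∈ live)
    (hvu : ∀ y ∈ E, μ.Matched (v y) (u y)) (hinj : Set.InjOn v E)
    (hs : ∀ y ∈ E, P.Spread i live σ k y (v y) (u y))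
    (hfew : ∀ y ∈ E, ((P.edgeHits live σ (v y) (u y)).card : ℝ) ≤ η * live.card) :
    (E.card : ℝ) ≤ 7 * P.rho * ((P.t : ℝ) ^ P.epsLevel i) ^ 4 * η * live.card := by
  classical
  have hX : 0 < (P.t : ℝ) ^ P.epsLevel i := hP.pos_rpow _
  have hrho : 0 < P.rho := lt_of_lt_of_le one_pos hP.one_le_rho
  have h1 : E.card = ∑ I ∈ P.intervalsAt k, (E.filter fun y => P.blockOf (v y) k = I).card :=
    Finset.card_eq_sum_card_fiberwise fun y _ =>
      Finset.mem_image.2 ⟨v y, Finset.mem_univ _, rfl⟩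
  rw [h1]
  push_cast
  calc _ ≤ ∑ I ∈ P.intervalsAt k, P.rho * ((P.t : ℝ) ^ P.epsLevel i) ^ 4 * η *
        ((live ∩ P.scaled 7 I).card : ℝ) := by
        refine Finset.sum_le_sum fun I hI => ?_
        obtain ⟨w, -, rfl⟩ := Finset.mem_image.1 hI
        have hsub := Finset.filter_subset (fun y => P.blockOf (v y) k = P.blockOf w k) E
        exact hP.card_spread_block_le hE hγ hμ hk v u hη _ (fun y hy => hmem y (hsub hy))
          (fun y hy => hvu y (hsub hy)) (hinj.mono (Finset.coe_subset.2 hsub))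
          (fun y hy => hs y (hsub hy)) (fun y hy => (Finset.mem_filter.1 hy).2)
          (fun y hy => hfew y (hsub hy))
    _ ≤ P.rho * ((P.t : ℝ) ^ P.epsLevel i) ^ 4 * η * (7 * live.card) := by
        rw [← Finset.mul_sum]
        exact mul_le_mul_of_nonneg_left (hP.sum_card_inter_scaled_le' (by norm_num) k live)
          (by positivity)
    _ = _ := by ring

/-! ### One run of the query algorithm -/

/-- The algorithm discovers an edge with high probability if, for some threshold, a fraction of about
`1 / ρ` of the choices of a live window leads to its discovery. -/
theorem Large.hitProb_query_succ_ge (hP : P.Large) {r i : ℕ} {live A : Finset P.Win} {τ : ℕ}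
    {y z : P.Win} (hτ : τ ∈ P.thresholds) (hne : live.Nonempty) (hA : A ⊆ live)
    (hcard : P.rho⁻¹ * ((P.t : ℝ) ^ P.epsLevel i) ^ 50 ≤
      A.card / live.card * ((P.t : ℝ) ^ P.epsLevel i) ^ 100)
    (hx : ∀ x ∈ A,
      P.IsBig live (P.clique live x τ) ∧ y ∈ P.clique live x τ ∧ z ∈ P.clique live x τ ∨
      ¬ P.IsBig live (P.clique live x τ) ∧
        1 / 2 ≤ hitProb (P.query r (i + 1) (P.nextLive live (P.clique live x τ))) (y, z)) :
    1 - Real.exp (-(P.t : ℝ) ^ P.epsLevel i) ≤ hitProb (P.query (r + 1) i live) (y, z) := by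
  classical
  have hrho : 0 < P.rho := lt_of_lt_of_le one_pos hP.one_le_rho
  have hX1 := hP.one_le_X i
  have hX50 := hP.const_mul_le i
  have hT : (0 : ℝ) < P.tauMax := by
    unfold tauMax
    have := P.invEps_pos
    positivity
  have hTb : 2 * (P.tauMax : ℝ) ≤ (P.t : ℝ) ^ P.epsLevel i := by
    refine le_trans ?_ hX50
    have hN : (1 : ℝ) ≤ P.invEps := by exact_mod_cast P.invEps_pos
    have h1 := hP.const_le_base'
    have h2 : (P.invEps : ℝ) ^ 3 ≤ (P.invEps : ℝ) ^ 10 := pow_le_pow_right₀ hN (by norm_num)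
    have h3 : (P.base : ℝ) ≤ P.base ^ 4 :=
      le_self_pow₀ (by linarith [hP.base_ge_real]) (by norm_num)
    unfold tauMax
    push_cast
    linarith [hP.base_ge_real]
  have hl : (0 : ℝ) < live.card := Nat.cast_pos.2 hne.card_pos
  rw [query]
  refine hitProb_repeatUnion_ge _ _ _ (q := A.card / live.card * (1 / (2 * P.tauMax))) ?_ ?_
  · rw [dif_pos hne, hitProb_uniform_bind, div_mul_eq_mul_div]
    refine div_le_div_of_nonneg_right ?_ hl.le
    rw [← nsmul_eq_mul, ← Finset.sum_const]
    refine (Finset.sum_le_sum fun x hxA => ?_).trans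
      (Finset.sum_le_sum_of_subset_of_nonneg hA fun _ _ _ => hitProb_nonneg _ _)
    rw [hitProb_uniform_bind, thresholds, Nat.card_Icc, Nat.add_sub_cancel, ← div_div]
    refine div_le_div_of_nonneg_right ?_ hT.le
    refine le_trans ?_ (Finset.single_le_sum (fun _ _ => hitProb_nonneg _ _) hτ)
    rcases hx x hxA with ⟨hb, hy, hz⟩ | ⟨hb, hh⟩
    · rw [if_pos hb, hitProb_pure_of_mem (Finset.mem_product.2 ⟨hy, hz⟩)]
      norm_num
    · rw [if_neg hb]
      exact hh
  · have hm : ((P.t : ℝ) ^ P.epsLevel i) ^ 100 * P.rho ≤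
        (⌈(P.t : ℝ) ^ P.epsLevel (i + 1) * P.rho⌉₊ : ℝ) := by
      rw [← t_rpow_epsLevel_succ]
      exact Nat.le_ceil _
    set X := (P.t : ℝ) ^ P.epsLevel i
    have hX0 : 0 < X := by linarith
    calc X ≤ X ^ 50 * (1 / X) := by
          rw [mul_one_div, le_div_iff₀ hX0, ← pow_two]
          exact pow_le_pow_right₀ hX1 (by norm_num)
      _ ≤ X ^ 50 * (1 / (2 * P.tauMax)) := by gcongr
      _ = (P.rho⁻¹ * X ^ 50) * ((1 / (2 * P.tauMax)) * P.rho) := by field_simp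
      _ ≤ (A.card / live.card * X ^ 100) * ((1 / (2 * P.tauMax)) * P.rho) := by gcongr
      _ = A.card / live.card * (1 / (2 * P.tauMax)) * (X ^ 100 * P.rho) := by ring
      _ ≤ _ := by gcongr

/-! ### Good windows -/

theorem Mapping.card_image_le {μ : P.Mapping} (hμ : μ.Valid) (K : Finset P.Win) :
    (μ.image K).card ≤ K.card := by
  classical
  have h : ∀ z ∈ μ.image K, ∃ y, y ∈ K ∧ μ.Matched y z := fun z hz => Mapping.mem_image.1 hz
  choose! f hf hf' using h
  refine Finset.card_le_card_of_injOn f (fun z hz => hf z hz) fun z hz z' hz' hzz => ?_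
  have h1 := hf' z hz
  rw [hzz] at h1
  exact h1.right_unique hμ (hf' z' hz')

theorem mem_good {μ : P.Mapping} {i : ℕ} {live : Finset P.Win} {y : P.Win} :
    y ∈ P.good μ i live ↔ y ∈ P.decreasing i live ∧
      ∃ z ∈ P.decreasing i live, μ.Matched y z := by
  rw [good, Finset.mem_inter, Mapping.mem_image]
  exact and_congr_right fun _ => exists_congr fun z => and_congr_right fun _ =>
    ⟨Mapping.Matched.symm, Mapping.Matched.symm⟩

theorem good_subset {μ : P.Mapping} {i : ℕ} {live : Finset P.Win} :
    P.good μ i live ⊆ live ∩ μ.image live := by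
  intro y hy
  obtain ⟨hy, z, hz, hyz⟩ := mem_good.1 hy
  exact Finset.mem_inter.2 ⟨(mem_decreasing.1 hy).1,
    Mapping.mem_image.2 ⟨z, (mem_decreasing.1 hz).1, hyz.symm⟩⟩

theorem card_sdiff_good_le {μ : P.Mapping} (hμ : μ.Valid) (i : ℕ) (live : Finset P.Win) :
    ((live ∩ μ.image live) \ P.good μ i live).card ≤
      2 * (live \ P.decreasing i live).card := by
  classical
  have h : (live ∩ μ.image live) \ P.good μ i live ⊆
      (live \ P.decreasing i live) ∪ μ.image (live \ P.decreasing i live) := by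
    intro y hy
    obtain ⟨h1, h2⟩ := Finset.mem_sdiff.1 hy
    obtain ⟨hy, hy'⟩ := Finset.mem_inter.1 h1
    obtain ⟨z, hz, hzy⟩ := Mapping.mem_image.1 hy'
    rw [Finset.mem_union, Finset.mem_sdiff, Mapping.mem_image]
    by_cases hd : y ∈ P.decreasing i live
    · refine Or.inr ⟨z, Finset.mem_sdiff.2 ⟨hz, fun hz' => h2 ?_⟩, hzy⟩
      exact mem_good.2 ⟨hd, z, hz', hzy.symm⟩
    · exact Or.inl ⟨hy, hd⟩
  have h1 := (Finset.card_le_card h).trans (Finset.card_union_le _ _)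
  have h2 := Mapping.card_image_le hμ (live \ P.decreasing i live)
  omega

/-- The matching pairs the good windows of `𝒜` with those of `ℬ`. -/
theorem card_good_le_side {μ : P.Mapping} (hμ : μ.Valid) (i : ℕ) (live : Finset P.Win)
    (s : Bool) :
    (P.good μ i live).card ≤ 2 * (live.filter fun u => P.onA u = s).card := by
  classical
  have h1 := Finset.card_filter_add_card_filter_not (s := P.good μ i live) (fun u => P.onA u = s)
  have h2 : ((P.good μ i live).filter fun u => ¬ P.onA u = s) ⊆
      μ.image (live.filter fun u => P.onA u = s) := by
    intro y hy
    obtain ⟨hy, hys⟩ := Finset.mem_filter.1 hy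
    obtain ⟨hy, z, hz, hyz⟩ := mem_good.1 hy
    refine Mapping.mem_image.2 ⟨z, Finset.mem_filter.2 ⟨(mem_decreasing.1 hz).1, ?_⟩, hyz.symm⟩
    rw [hyz.onA_ne]
    revert hys
    cases P.onA y <;> cases s <;> simp
  have h3 := (Finset.card_le_card h2).trans (Mapping.card_image_le hμ _)
  have h4 : ((P.good μ i live).filter fun u => P.onA u = s).card ≤
      (live.filter fun u => P.onA u = s).card :=
    Finset.card_le_card (Finset.filter_subset_filter _ fun y hy =>
      (mem_decreasing.1 (mem_good.1 hy).1).1)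
  omega

/-! ### The inductive step -/

variable (P) in
/-- The window `y` is good, and with `r` levels remaining the call at level `i` discovers the edge of
`y` with high probability. -/
def SurvivesBelow (μ : P.Mapping) (r i : ℕ) (live : Finset P.Win) (y : P.Win) : Prop :=
  y ∈ P.good μ i live ∧ ∃ z, μ.Matched y z ∧
    1 - Real.exp (-(P.t : ℝ) ^ P.epsLevel i) ≤ hitProb (P.query r i live) (y, z)

open Classical in
variable (P) in
/-- The live windows with a live mate that do not survive. -/
noncomputable def lost (μ : P.Mapping) (r i : ℕ) (live : Finset P.Win) : Finset P.Win :=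
  (live ∩ μ.image live).filter fun y => ¬ P.SurvivesBelow μ r i live y

open Classical in
variable (P) in
/-- The live windows `x` such that the choice of `x` and the threshold `σ + 1` leads to a child at
which `y` and its mate are live, but `y` does not survive. -/
noncomputable def failures (μ : P.Mapping) (r i : ℕ) (live : Finset P.Win) (σ : ℕ) (y : P.Win) :
    Finset P.Win :=
  live.filter fun x => y ∈ P.lost μ r (i + 1) (P.nextLive live (P.clique live x (σ + 1)))

theorem mem_lost {μ : P.Mapping} {r i : ℕ} {live : Finset P.Win} {y : P.Win} :
    y ∈ P.lost μ r i live ↔ y ∈ live ∩ μ.image live ∧ ¬ P.SurvivesBelow μ r i live y :=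
  @Finset.mem_filter _ _ (_) _ _

namespace Large

variable (hP : P.Large)
include hP

theorem const_le_X {C : ℝ} {n : ℕ} (hC : C ≤ (P.base : ℝ) ^ n) (hn : n ≤ 50) (i : ℕ) :
    C ≤ (P.t : ℝ) ^ P.epsLevel i :=
  (hC.trans (pow_le_pow_right₀ (by linarith [hP.base_ge_real]) hn)).trans (hP.base_pow_le i)

/-- A bound for active nodes extends to all sets of live windows: at an inactive one, hardly any
windows have a live mate. -/
theorem card_lost_le {μ : P.Mapping} (hμ : μ.Valid) {r i : ℕ} (live : Finset P.Win)
    (h : P.IsActive μ i live → ((P.lost μ r i live).card : ℝ) ≤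
      2 * ((P.t : ℝ) ^ P.epsLevel i)⁻¹ * (live ∩ μ.image live).card) :
    ((P.lost μ r i live).card : ℝ) ≤ 2 * ((P.t : ℝ) ^ P.epsLevel i)⁻¹ * live.card := by
  classical
  have hX1 := hP.one_le_X i
  have hX : 0 < (P.t : ℝ) ^ P.epsLevel i := by linarith
  have hsub : ((live ∩ μ.image live).card : ℝ) ≤ live.card :=
    Nat.cast_le.2 (Finset.card_le_card Finset.inter_subset_left)
  by_cases hact : P.IsActive μ i live
  · exact (h hact).trans (by gcongr)
  · rcases live.eq_empty_or_nonempty with rfl | hne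
    · simp [lost]
    have hl : (0 : ℝ) < live.card := Nat.cast_pos.2 hne.card_pos
    unfold IsActive at hact
    rw [not_le, div_lt_iff₀ hl, Real.rpow_neg (Nat.cast_nonneg _)] at hact
    have h1 : ((P.lost μ r i live).card : ℝ) ≤ (live ∩ μ.image live).card :=
      Nat.cast_le.2 (Finset.card_le_card (Finset.filter_subset _ _))
    have h2 : (((live ∩ μ.image live) \ P.good μ i live).card : ℝ) + (P.good μ i live).card =
        (live ∩ μ.image live).card := by
      exact_mod_cast Finset.card_sdiff_add_card_eq_card good_subset
    have h3 : (((live ∩ μ.image live) \ P.good μ i live).card : ℝ) ≤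
        2 * (live \ P.decreasing i live).card := by exact_mod_cast card_sdiff_good_le hμ i live
    have h4 := hP.card_sdiff_decreasing_le i live
    have hb : 2 * (P.base : ℝ) ≤ (P.t : ℝ) ^ P.epsLevel i :=
      hP.const_le_X (n := 2) (by nlinarith [hP.base_ge_real]) (by norm_num) i
    set X := (P.t : ℝ) ^ P.epsLevel i
    have h5 : 2 * (P.base * (X ^ 3)⁻¹ * live.card) ≤ X⁻¹ * live.card := by
      calc _ = (2 * P.base) * (X ^ 3)⁻¹ * live.card := by ring
        _ ≤ X * (X ^ 3)⁻¹ * live.card := by gcongr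
        _ = (X ^ 2)⁻¹ * live.card := by field_simp
        _ ≤ (X ^ 1)⁻¹ * live.card := by gcongr; norm_num
        _ = _ := by rw [pow_one]
    linarith

theorem sum_card_failures_le {μ : P.Mapping} (hE : P.Accurate) {r i : ℕ}
    (ih : ∀ live, ((P.lost μ r (i + 1) live).card : ℝ) ≤
      2 * ((P.t : ℝ) ^ P.epsLevel (i + 1))⁻¹ * live.card)
    (live G : Finset P.Win) (σ : ℕ) :
    ∑ y ∈ G, ((P.failures μ r i live σ y).card : ℝ) ≤
      2 * (((P.t : ℝ) ^ P.epsLevel i) ^ 100)⁻¹ * (P.base ^ 3 * P.rho⁻¹ * live.card) *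
        live.card := by
  classical
  have hX := hP.pos_rpow (P.epsLevel i)
  have h1 : ∑ y ∈ G, (P.failures μ r i live σ y).card ≤ ∑ x ∈ live,
      (P.lost μ r (i + 1) (P.nextLive live (P.clique live x (σ + 1)))).card := by
    simp only [failures, Finset.card_filter]
    rw [Finset.sum_comm]
    refine Finset.sum_le_sum fun x _ => ?_
    rw [← Finset.card_filter, Finset.filter_mem_eq_inter]
    exact Finset.card_le_card Finset.inter_subset_right
  calc _ ≤ ∑ x ∈ live,
      ((P.lost μ r (i + 1) (P.nextLive live (P.clique live x (σ + 1)))).card : ℝ) := by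
        exact_mod_cast h1
    _ ≤ ∑ x ∈ live, 2 * (((P.t : ℝ) ^ P.epsLevel i) ^ 100)⁻¹ *
          (P.base ^ 3 * P.rho⁻¹ * live.card) := by
        refine Finset.sum_le_sum fun x hx => (ih _).trans ?_
        rw [t_rpow_epsLevel_succ]
        gcongr
        exact hP.card_nextLive_le ⟨x, hE.mem_clique_self hx⟩
    _ = _ := by rw [Finset.sum_const, nsmul_eq_mul]; ring

/-- By Markov's inequality, few windows get lost at the children for many of the choices. -/
theorem card_many_failures_le {μ : P.Mapping} (hE : P.Accurate) {r i : ℕ}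
    (ih : ∀ live, ((P.lost μ r (i + 1) live).card : ℝ) ≤
      2 * ((P.t : ℝ) ^ P.epsLevel (i + 1))⁻¹ * live.card)
    {live G : Finset P.Win} (hGl : G ⊆ live) (σ : ℕ) (hG : ∀ y ∈ G,
      P.rho⁻¹ * (((P.t : ℝ) ^ P.epsLevel i) ^ 10)⁻¹ * live.card ≤
        2 * (P.failures μ r i live σ y).card) :
    (G.card : ℝ) ≤ 4 * P.base ^ 3 * (((P.t : ℝ) ^ P.epsLevel i) ^ 90)⁻¹ * live.card := by
  have h1 := hP.sum_card_failures_le hE ih live G σ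
  have hX := hP.pos_rpow (P.epsLevel i)
  have hrho : 0 < P.rho := lt_of_lt_of_le one_pos hP.one_le_rho
  set X := (P.t : ℝ) ^ P.epsLevel i
  rcases live.eq_empty_or_nonempty with rfl | hne
  · simp [Finset.subset_empty.1 hGl]
  have hl : (0 : ℝ) < live.card := Nat.cast_pos.2 hne.card_pos
  have h2 : G.card * (P.rho⁻¹ * (X ^ 10)⁻¹ * live.card) ≤
      2 * ∑ y ∈ G, ((P.failures μ r i live σ y).card : ℝ) := by
    rw [← nsmul_eq_mul, ← Finset.sum_const, Finset.mul_sum]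
    exact Finset.sum_le_sum hG
  refine le_of_mul_le_mul_right ?_ (show 0 < P.rho⁻¹ * (X ^ 10)⁻¹ * live.card by positivity)
  refine h2.trans ((mul_le_mul_of_nonneg_left h1 zero_le_two).trans_eq ?_)
  field_simp
  ring

end Large

theorem mem_lost_or_survives {μ : P.Mapping} {r i : ℕ} {live : Finset P.Win} {y z : P.Win}
    (hμ : μ.Valid) (hy : y ∈ live) (hz : z ∈ live) (hyz : μ.Matched y z)
    (h : y ∉ P.lost μ r i live) :
    1 - Real.exp (-(P.t : ℝ) ^ P.epsLevel i) ≤ hitProb (P.query r i live) (y, z) := by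
  have h1 : P.SurvivesBelow μ r i live y := by
    by_contra hc
    exact h (mem_lost.2 ⟨Finset.mem_inter.2 ⟨hy, Mapping.mem_image.2 ⟨z, hz, hyz.symm⟩⟩, hc⟩)
  obtain ⟨-, z', hz', hh⟩ := h1
  rwa [hyz.right_unique hμ hz']

/-- With no level remaining, all good windows survive. -/
theorem survivesBelow_zero (hE : P.Accurate) {μ : P.Mapping} (hμ : μ.Valid) {i : ℕ}
    {live : Finset P.Win} {y : P.Win} (hy : y ∈ P.good μ i live) :
    P.SurvivesBelow μ 0 i live y := by
  classical
  obtain ⟨hyd, z, hzd, hyz⟩ := mem_good.1 hy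
  refine ⟨hy, z, hyz, ?_⟩
  have h1 := (mem_decreasing.1 hyd).1
  have h2 := (mem_decreasing.1 hzd).1
  have h3 := (Finset.mem_filter.1 (hE.mate_mem_clique hμ hyz h2 (τ := 0))).2
  rw [query, hitProb_pure_of_mem
    (Finset.mem_filter.2 ⟨Finset.mem_product.2 ⟨h1, h2⟩, by simpa using h3⟩)]
  linarith [Real.exp_pos (-(P.t : ℝ) ^ P.epsLevel i)]

/-- A window survives if it is discovered in big cliques, or if most of the choices that lead to
children with its edge lead to children at which it survives. -/
theorem Large.survivesBelow_succ (hP : P.Large) (hE : P.Accurate)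
    {μ : P.Mapping} (hμ : μ.Valid) {r i : ℕ} {live : Finset P.Win} {y z : P.Win} {σ : ℕ}
    (hy : y ∈ P.good μ i live) (hyz : μ.Matched y z) (hσ : 1 ≤ σ) (hσ' : σ + 1 ≤ P.tauMax)
    (h : ((∀ x ∈ P.clique live y σ, P.IsBig live (P.clique live x (σ + 1))) ∧
          P.rho⁻¹ * live.card ≤ P.base * (P.clique live y σ).card) ∨
        P.rho⁻¹ * (((P.t : ℝ) ^ P.epsLevel i) ^ 10)⁻¹ * live.card <
            (P.edgeHits live σ y z).card ∧
          2 * ((P.failures μ r i live σ y).card : ℝ) <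
            P.rho⁻¹ * (((P.t : ℝ) ^ P.epsLevel i) ^ 10)⁻¹ * live.card) :
    P.SurvivesBelow μ (r + 1) i live y := by
  classical
  refine ⟨hy, z, hyz, ?_⟩
  obtain ⟨hyd, z', hzd, hyz'⟩ := mem_good.1 hy
  obtain rfl := hyz.right_unique hμ hyz'
  have hyl := (mem_decreasing.1 hyd).1
  have hzl := (mem_decreasing.1 hzd).1
  have hrho : 0 < P.rho := lt_of_lt_of_le one_pos hP.one_le_rho
  have hX1 := hP.one_le_X i
  have hl : (0 : ℝ) < live.card := Nat.cast_pos.2 (Finset.card_pos.2 ⟨y, hyl⟩)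
  have hτ : σ + 1 ∈ P.thresholds := Finset.mem_Icc.2 ⟨by omega, hσ'⟩
  rcases h with ⟨hbig, hcard⟩ | ⟨hhits, hfail⟩
  · have hbX : (P.base : ℝ) ≤ (P.t : ℝ) ^ P.epsLevel i :=
      hP.const_le_X (n := 1) (by rw [pow_one]) (by norm_num) i
    refine hP.hitProb_query_succ_ge hτ ⟨y, hyl⟩ (clique_subset live y σ) ?_ ?_
    · set X := (P.t : ℝ) ^ P.epsLevel i
      have hX0 : 0 < X := by linarith
      rw [div_mul_eq_mul_div, le_div_iff₀ hl]
      calc P.rho⁻¹ * X ^ 50 * live.card = X ^ 50 * (P.rho⁻¹ * live.card) := by ring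
        _ ≤ X ^ 50 * (P.base * (P.clique live y σ).card) := by gcongr
        _ ≤ X ^ 50 * (X * (P.clique live y σ).card) := by gcongr
        _ = (P.clique live y σ).card * X ^ 51 := by ring
        _ ≤ _ := by gcongr; norm_num
    · intro x hx
      obtain ⟨τ, rfl⟩ : ∃ τ, σ = τ + 1 := ⟨σ - 1, by omega⟩
      exact Or.inl ⟨hbig x hx, hE.clique_subset_clique hx (hE.mem_clique_self hyl),
        hE.clique_subset_clique hx (hE.mate_mem_clique hμ hyz hzl)⟩
  · refine hP.hitProb_query_succ_ge (A := P.edgeHits live σ y z \ P.failures μ r i live σ y)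
      hτ ⟨y, hyl⟩ (Finset.sdiff_subset.trans (Finset.filter_subset _ _)) ?_ ?_
    · have h2 : (2 : ℝ) ≤ (P.t : ℝ) ^ P.epsLevel i :=
        hP.const_le_X (n := 1) (by rw [pow_one]; linarith [hP.base_ge_real]) (by norm_num) i
      have h3 : ((P.edgeHits live σ y z).card : ℝ) ≤
          (P.edgeHits live σ y z \ P.failures μ r i live σ y).card +
            (P.failures μ r i live σ y).card := by
        have h4 := Finset.card_le_card_sdiff_add_card (s := P.edgeHits live σ y z)
          (t := P.failures μ r i live σ y)
        exact_mod_cast h4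
      set X := (P.t : ℝ) ^ P.epsLevel i
      have hX0 : 0 < X := by linarith
      set a : ℝ := ((P.edgeHits live σ y z \ P.failures μ r i live σ y).card : ℝ)
      have h5 : P.rho⁻¹ * (X ^ 10)⁻¹ * live.card ≤ 2 * a := by linarith
      have ha : 0 ≤ a := Nat.cast_nonneg _
      rw [div_mul_eq_mul_div, le_div_iff₀ hl]
      calc P.rho⁻¹ * X ^ 50 * live.card = X ^ 60 * (P.rho⁻¹ * (X ^ 10)⁻¹ * live.card) := by
            field_simp
        _ ≤ X ^ 60 * (2 * a) := by gcongr
        _ ≤ X ^ 60 * (X * a) := by gcongr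
        _ = a * X ^ 61 := by ring
        _ ≤ _ := by gcongr; norm_num
    · intro x hx
      obtain ⟨hx1, hx2⟩ := Finset.mem_sdiff.1 hx
      obtain ⟨hxl, hnb, hyM, hzM⟩ := Finset.mem_filter.1 hx1
      refine Or.inr ⟨hnb, ?_⟩
      have h1 := mem_lost_or_survives hμ hyM hzM hyz
        fun hlost => hx2 (Finset.mem_filter.2 ⟨hxl, hlost⟩)
      refine le_trans ?_ h1
      have h2 : Real.exp (-(P.t : ℝ) ^ P.epsLevel (i + 1)) ≤ Real.exp (-1) :=
        Real.exp_le_exp.2 (by linarith [hP.one_le_X (i + 1)])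
      have h3 : Real.exp (-1) < 1 / 2 := by
        have := Real.exp_neg_one_lt_d9
        linarith
      linarith

/-- The inductive step: the good windows that do not survive are few. -/
theorem Large.card_good_not_survives_le (hP : P.Large) (hE : P.Accurate) (hγ : 1 ≤ P.γ)
    {μ : P.Mapping} (hμ : μ.Valid) {r i : ℕ}
    (ih : ∀ live, ((P.lost μ r (i + 1) live).card : ℝ) ≤
      2 * ((P.t : ℝ) ^ P.epsLevel (i + 1))⁻¹ * live.card)
    {live : Finset P.Win}
    (hside : ∀ s : Bool, (live.card : ℝ) ≤ 2 * (P.t : ℝ) ^ P.epsLevel i *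
      (live.filter fun u => P.onA u = s).card)
    (B : Finset P.Win) (hB : B ⊆ P.good μ i live)
    (hB' : ∀ y ∈ B, ¬ P.SurvivesBelow μ (r + 1) i live y) :
    (B.card : ℝ) ≤ 2 * P.base ^ 4 * (((P.t : ℝ) ^ P.epsLevel i) ^ 3)⁻¹ * live.card := by
  classical
  have hrho : 0 < P.rho := lt_of_lt_of_le one_pos hP.one_le_rho
  have hX1 := hP.one_le_X i
  have hmate : ∀ y, y ∈ B → ∃ z, z ∈ P.decreasing i live ∧ μ.Matched y z := fun y hy =>
    let ⟨_, z, hz, hyz⟩ := mem_good.1 (hB hy)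
    ⟨z, hz, hyz⟩
  choose! mate hmd hm using hmate
  have hyd : ∀ y ∈ B, y ∈ P.decreasing i live := fun y hy => (mem_good.1 (hB hy)).1
  set X := (P.t : ℝ) ^ P.epsLevel i with hXdef
  have hX0 : 0 < X := by linarith
  -- `η` beats the factor `ρ * X ^ 4` of `card_spread_le` by a power of `X`, and is still far
  -- larger than the fraction `X ^ (-100) / ρ` of the choices that lose a typical window
  set η := P.rho⁻¹ * (X ^ 10)⁻¹ with hη
  have hη0 : 0 ≤ η := by positivity
  let R : ℕ → ℕ → (P.Win → P.Win) → (P.Win → P.Win) → Finset P.Win := fun σ k v u =>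
    B.filter fun y => P.Spread i live (σ + 1) k y (v y) (u y) ∧
      ((P.edgeHits live (σ + 1) (v y) (u y)).card : ℝ) ≤ η * live.card
  let F : ℕ → Finset P.Win := fun σ =>
    B.filter fun y => η * live.card ≤ 2 * ((P.failures μ r i live (σ + 1) y).card : ℝ)
  -- a good window which is in none of these sets survives
  have hcover : B ⊆ (Finset.range P.tauMax).biUnion fun σ =>
      ((Finset.range (P.invEps + 1)).biUnion fun k => R σ k id mate ∪ R σ k mate id) ∪ F σ := by
    intro y hy
    obtain ⟨σ, hσ, hσ', hcase⟩ :=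
      hP.big_or_spread hE hμ (hyd y hy) (hmd y hy) (hm y hy) hside
    obtain ⟨τ, rfl⟩ : ∃ τ, σ = τ + 1 := ⟨σ - 1, by omega⟩
    refine Finset.mem_biUnion.2 ⟨τ, Finset.mem_range.2 (by omega), Finset.mem_union.2 ?_⟩
    rcases hcase with hbig | ⟨k, hk, hs⟩
    · exact absurd (hP.survivesBelow_succ hE hμ (hB hy) (hm y hy) hσ hσ' (Or.inl hbig)) (hB' y hy)
    by_cases hf : η * live.card ≤ 2 * ((P.failures μ r i live (τ + 1) y).card : ℝ)
    · exact Or.inr (Finset.mem_filter.2 ⟨hy, hf⟩)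
    have hfew : ((P.edgeHits live (τ + 1) y (mate y)).card : ℝ) ≤ η * live.card := by
      by_contra hc
      exact hB' y hy (hP.survivesBelow_succ hE hμ (hB hy) (hm y hy) hσ hσ'
        (Or.inr ⟨not_le.1 hc, not_le.1 hf⟩))
    refine Or.inl (Finset.mem_biUnion.2 ⟨k, Finset.mem_range.2 (Nat.lt_succ_of_le hk),
      Finset.mem_union.2 ?_⟩)
    rcases hs with hs | hs
    · exact Or.inl (Finset.mem_filter.2 ⟨hy, hs, hfew⟩)
    · exact Or.inr (Finset.mem_filter.2 ⟨hy, hs, by rwa [edgeHits_comm]⟩)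
  have hself : ∀ y ∈ B, ∀ σ, y ∈ P.clique live y (σ + 1) := fun y hy σ =>
    hE.mem_clique_self (mem_decreasing.1 (hyd y hy)).1
  have hmC : ∀ y ∈ B, ∀ σ, mate y ∈ P.clique live y (σ + 1) := fun y hy σ =>
    hE.mate_mem_clique hμ (hm y hy) (mem_decreasing.1 (hmd y hy)).1
  have hRη : 7 * P.rho * X ^ 4 * η = 7 * (X ^ 6)⁻¹ := by
    rw [hη]; field_simp
  have hR1 : ∀ σ, ∀ k ∈ Finset.range (P.invEps + 1),
      ((R σ k id mate).card : ℝ) ≤ 7 * (X ^ 6)⁻¹ * live.card := by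
    intro σ k hk
    have hsub : R σ k id mate ⊆ B := Finset.filter_subset _ _
    rw [← hRη]
    refine hP.card_spread_le hE hγ hμ (σ := σ + 1) (Nat.lt_succ_iff.1 (Finset.mem_range.1 hk))
      id mate hη0 _
      (fun y hy => ⟨hself y (hsub hy) σ, hself y (hsub hy) σ, (mem_decreasing.1 (hmd y (hsub hy))).1⟩)
      (fun y hy => hm y (hsub hy)) Function.injective_id.injOn
      (fun y hy => (Finset.mem_filter.1 hy).2.1) (fun y hy => (Finset.mem_filter.1 hy).2.2)
  have hR2 : ∀ σ, ∀ k ∈ Finset.range (P.invEps + 1),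
      ((R σ k mate id).card : ℝ) ≤ 7 * (X ^ 6)⁻¹ * live.card := by
    intro σ k hk
    have hsub : R σ k mate id ⊆ B := Finset.filter_subset _ _
    rw [← hRη]
    refine hP.card_spread_le hE hγ hμ (σ := σ + 1) (Nat.lt_succ_iff.1 (Finset.mem_range.1 hk))
      mate id hη0 _
      (fun y hy => ⟨hself y (hsub hy) σ, hmC y (hsub hy) σ, (mem_decreasing.1 (hyd y (hsub hy))).1⟩)
      (fun y hy => (hm y (hsub hy)).symm) ?_
      (fun y hy => (Finset.mem_filter.1 hy).2.1) (fun y hy => (Finset.mem_filter.1 hy).2.2)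
    intro y hy y' hy' hyy
    have h1 := (hm y (hsub hy)).symm
    rw [hyy] at h1
    exact h1.right_unique hμ (hm y' (hsub hy')).symm
  have hF : ∀ σ, ((F σ).card : ℝ) ≤ 4 * P.base ^ 3 * (X ^ 90)⁻¹ * live.card := fun σ =>
    hP.card_many_failures_le hE ih ((Finset.filter_subset _ _).trans fun y hy =>
      (mem_decreasing.1 (hyd y hy)).1) (σ + 1) fun y hy => (Finset.mem_filter.1 hy).2
  have hsum : B.card ≤ ∑ σ ∈ Finset.range P.tauMax, ((∑ k ∈ Finset.range (P.invEps + 1),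
      ((R σ k id mate).card + (R σ k mate id).card)) + (F σ).card) := by
    refine (Finset.card_le_card hcover).trans ?_
    refine Finset.card_biUnion_le.trans (Finset.sum_le_sum fun σ _ => ?_)
    refine (Finset.card_union_le _ _).trans (Nat.add_le_add_right ?_ _)
    exact Finset.card_biUnion_le.trans (Finset.sum_le_sum fun k _ => Finset.card_union_le _ _)
  have hN : (1 : ℝ) ≤ P.invEps := by exact_mod_cast P.invEps_pos
  have hb := hP.base_ge_real
  have hX3 : (X ^ 6)⁻¹ ≤ (X ^ 3)⁻¹ := by gcongr; norm_num
  have hX3' : (X ^ 90)⁻¹ ≤ (X ^ 3)⁻¹ := by gcongr; norm_num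
  have hNb := hP.const_le_base'
  have hN4 : (P.invEps : ℝ) ^ 4 ≤ (P.invEps : ℝ) ^ 10 := pow_le_pow_right₀ hN (by norm_num)
  have hN3 : 200 * (P.invEps : ℝ) ^ 3 ≤ (P.invEps : ℝ) ^ 4 := by
    have : (200 : ℝ) ≤ P.invEps := by exact_mod_cast P.invEps_ge
    rw [pow_succ' _ 3]
    gcongr
  have hT : (P.tauMax : ℝ) = 1000 * (P.invEps : ℝ) ^ 3 := by unfold tauMax; push_cast; ring
  have hT1 : (P.tauMax : ℝ) * ((P.invEps + 1) * 14) ≤ P.base ^ 4 := by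
    calc (P.tauMax : ℝ) * ((P.invEps + 1) * 14)
        = 14000 * ((P.invEps : ℝ) ^ 4 + (P.invEps : ℝ) ^ 3) := by rw [hT]; ring
      _ ≤ 1000 * P.base := by linarith
      _ ≤ P.base * P.base := by gcongr
      _ = (P.base : ℝ) ^ 2 := (pow_two _).symm
      _ ≤ _ := pow_le_pow_right₀ (by linarith) (by norm_num)
  have hT2 : (P.tauMax : ℝ) * (4 * P.base ^ 3) ≤ P.base ^ 4 := by
    calc (P.tauMax : ℝ) * (4 * P.base ^ 3)
        = (4 * (1000 * (P.invEps : ℝ) ^ 3)) * (P.base : ℝ) ^ 3 := by rw [hT]; ring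
      _ ≤ P.base * (P.base : ℝ) ^ 3 := by gcongr; linarith
      _ = _ := by ring
  calc (B.card : ℝ) ≤ ∑ σ ∈ Finset.range P.tauMax, ((∑ k ∈ Finset.range (P.invEps + 1),
      (((R σ k id mate).card : ℝ) + (R σ k mate id).card)) + (F σ).card) := by exact_mod_cast hsum
    _ ≤ ∑ σ ∈ Finset.range P.tauMax, ((∑ k ∈ Finset.range (P.invEps + 1),
          (7 * (X ^ 6)⁻¹ * live.card + 7 * (X ^ 6)⁻¹ * live.card)) +
            4 * P.base ^ 3 * (X ^ 90)⁻¹ * live.card) := by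
        refine Finset.sum_le_sum fun σ _ => add_le_add (Finset.sum_le_sum fun k hk => ?_) (hF σ)
        exact add_le_add (hR1 σ k hk) (hR2 σ k hk)
    _ = P.tauMax * ((P.invEps + 1) * 14) * ((X ^ 6)⁻¹ * live.card) +
          P.tauMax * (4 * P.base ^ 3) * ((X ^ 90)⁻¹ * live.card) := by
        simp only [Finset.sum_const, Finset.card_range, nsmul_eq_mul]
        push_cast
        ring
    _ ≤ P.base ^ 4 * ((X ^ 3)⁻¹ * live.card) + P.base ^ 4 * ((X ^ 3)⁻¹ * live.card) := by
        gcongr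
    _ = _ := by ring

/-- In an active node, it suffices that few of the good windows are lost. -/
theorem Large.card_lost_le_of_good (hP : P.Large) {μ : P.Mapping} (hμ : μ.Valid) {r i : ℕ}
    {live : Finset P.Win} (hact : P.IsActive μ i live)
    (h : (live.card : ℝ) ≤ (P.t : ℝ) ^ P.epsLevel i * (P.good μ i live).card →
      ((P.lost μ r i live ∩ P.good μ i live).card : ℝ) ≤
        2 * P.base ^ 4 * (((P.t : ℝ) ^ P.epsLevel i) ^ 3)⁻¹ * live.card) :
    ((P.lost μ r i live).card : ℝ) ≤
      2 * ((P.t : ℝ) ^ P.epsLevel i)⁻¹ * (live ∩ μ.image live).card := by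
  classical
  have hX1 := hP.one_le_X i
  have hb := hP.base_ge_real
  have hX0 : 0 < (P.t : ℝ) ^ P.epsLevel i := by linarith
  have hbX : 4 * (P.base : ℝ) ^ 4 ≤ (P.t : ℝ) ^ P.epsLevel i :=
    le_trans (by gcongr; norm_num) (hP.const_mul_le i)
  have hlive : (live.card : ℝ) ≤ (P.t : ℝ) ^ P.epsLevel i * (P.good μ i live).card := by
    rcases live.eq_empty_or_nonempty with rfl | hne
    · simp only [Finset.card_empty, Nat.cast_zero]; positivity
    unfold IsActive at hact
    rw [le_div_iff₀ (Nat.cast_pos.2 hne.card_pos), Real.rpow_neg (Nat.cast_nonneg _),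
      inv_mul_le_iff₀ hX0] at hact
    exact hact
  have h1 := h hlive
  have hsub : P.lost μ r i live ⊆ (P.lost μ r i live ∩ P.good μ i live) ∪
      ((live ∩ μ.image live) \ P.good μ i live) := by
    intro y hy
    by_cases hg : y ∈ P.good μ i live
    · exact Finset.mem_union_left _ (Finset.mem_inter.2 ⟨hy, hg⟩)
    · exact Finset.mem_union_right _ (Finset.mem_sdiff.2 ⟨(mem_lost.1 hy).1, hg⟩)
  have h2 : ((P.lost μ r i live).card : ℝ) ≤ (P.lost μ r i live ∩ P.good μ i live).card +
      2 * (live \ P.decreasing i live).card := by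
    exact_mod_cast ((Finset.card_le_card hsub).trans (Finset.card_union_le _ _)).trans
      (Nat.add_le_add_left (card_sdiff_good_le hμ i live) _)
  have h3 := hP.card_sdiff_decreasing_le i live
  have h4 : ((P.good μ i live).card : ℝ) ≤ (live ∩ μ.image live).card :=
    Nat.cast_le.2 (Finset.card_le_card good_subset)
  have hb4 : (P.base : ℝ) ≤ (P.base : ℝ) ^ 4 := le_self_pow₀ (by linarith) (by norm_num)
  set X := (P.t : ℝ) ^ P.epsLevel i
  have h5 : (P.base : ℝ) * (X ^ 3)⁻¹ * live.card ≤ P.base ^ 4 * (X ^ 3)⁻¹ * live.card := by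
    gcongr
  calc _ ≤ (4 * P.base ^ 4) * ((X ^ 3)⁻¹ * live.card) := by linarith
    _ ≤ X * ((X ^ 3)⁻¹ * (X * (live ∩ μ.image live).card)) := by
        gcongr
        exact hlive.trans (by gcongr)
    _ = 1 * X⁻¹ * (live ∩ μ.image live).card := by field_simp
    _ ≤ _ := by gcongr; norm_num

/-- All but few of the live windows of an active node whose mate is live survive. -/
theorem Large.card_lost_le_of_isActive (hP : P.Large) (hE : P.Accurate) (hγ : 1 ≤ P.γ)
    {μ : P.Mapping} (hμ : μ.Valid) (r i : ℕ) (live : Finset P.Win)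
    (hact : P.IsActive μ i live) :
    ((P.lost μ r i live).card : ℝ) ≤
      2 * ((P.t : ℝ) ^ P.epsLevel i)⁻¹ * (live ∩ μ.image live).card := by
  classical
  induction r generalizing i live with
  | zero =>
    refine hP.card_lost_le_of_good hμ hact fun _ => ?_
    have h : P.lost μ 0 i live ∩ P.good μ i live = ∅ :=
      Finset.eq_empty_of_forall_notMem fun y hy =>
        (mem_lost.1 (Finset.mem_inter.1 hy).1).2
          (survivesBelow_zero hE hμ (Finset.mem_inter.1 hy).2)
    have := hP.pos_rpow (P.epsLevel i)
    rw [h, Finset.card_empty, Nat.cast_zero]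
    positivity
  | succ r ih =>
    refine hP.card_lost_le_of_good hμ hact fun hlive => ?_
    refine hP.card_good_not_survives_le hE hγ hμ (r := r)
      (fun live' => hP.card_lost_le hμ live' (ih (i + 1) live')) (fun s => hlive.trans ?_) _
      Finset.inter_subset_right fun y hy => (mem_lost.1 (Finset.mem_inter.1 hy).1).2
    have h1 : ((P.good μ i live).card : ℝ) ≤ 2 * (live.filter fun u => P.onA u = s).card := by
      exact_mod_cast card_good_le_side hμ i live s
    have := hP.pos_rpow (P.epsLevel i)
    calc _ ≤ (P.t : ℝ) ^ P.epsLevel i * (2 * (live.filter fun u => P.onA u = s).card) := by gcongr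
      _ = _ := by ring

end QueryInput
end EDQuery

open Classical in
theorem lemma26 {S : Type*} (P : EDQuery.QueryInput S)
    (hL : 1 ≤ P.L) (hLmax : P.L ≤ P.Lmax) (himax : 1 ≤ P.imax)
    (hA : P.A.length = P.d ^ 2) (hB : P.B.length = P.d ^ 2)
    (hγ : 1 ≤ P.γ) (hγd : P.γ ∣ P.d ^ 2 - P.d)
    (ht : P.tMin ≤ P.t) (hΔ : 0 < P.Δ)
    (hsymm : ∀ x y, P.est x y = P.est y x)
    (hest : ∀ x y, (P.ED x y : ℝ) ≤ P.est x y ∧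
      P.est x y ≤ P.alpha (P.L - 1) * ((P.ED x y : ℝ) + P.Δ))
    (μ : P.Mapping) (hmono : μ.IsMonotone) (hskew : μ.SkewAtMost 2)
    (hclose : ∀ a b, μ a = some b → (P.ED (Sum.inl a) (Sum.inr b) : ℝ) ≤ P.Δ)
    (i : ℕ) (hi : i ≤ P.imax) (live : Finset P.Win)
    (hnode : P.IsNode i live) (hactive : P.IsActive μ i live) :
    (((live ∩ μ.image live).filter fun y => ¬ P.Survives μ i live y).card : ℝ) ≤
      2 * (P.t : ℝ) ^ (-P.epsLevel i) * ((live ∩ μ.image live).card : ℝ) := by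
  have hP : P.Large := ⟨hL, ht⟩
  have hE : P.Accurate := ⟨hΔ, hsymm, fun x y => (hest x y).1, fun x y => (hest x y).2⟩
  have h := hP.card_lost_le_of_isActive hE hγ ⟨hskew, hclose⟩ (P.imax - i) i live hactive
  rw [Real.rpow_neg (Nat.cast_nonneg _)]
  exact h
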